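/- Let $\mathcal S,\mathcal A$ be finite sets with $|\mathcal S||\mathcal A|\ge 2$, and consider a discounted MDP with transition probabilities $P_a(i,j)$, rewards $\hat r_{ija}\in[0,1]$, discount $\gamma\in(0,1)$, and $r_{ia}=\sum_j P_a(i,j)\hat r_{ija}$. Let $\xi=\frac1{|\mathcal S|}\mathbf 1$ and $\mathcal L=\{\lambda\in\mathbb R^{\mathcal S\times\mathcal A}:\lambda\ge 0,\ \|\lambda\|_1=(1-\gamma)^{-1}\}$. For nonnegative vectors write $KL(p\|q)=\sum_i p_i\log(p_i/q_i)$. Let $\mu$ be a probability distribution on $\mathcal S\times\mathcal A$ (the prior) with $\mu\ge\delta_0\mathbf 1$ for some $\delta_0>0$, let $$\rho(\lambda)=KL\big((1-\gamma)\lambda\,\|\,\mu\big),\qquad (\nabla\rho(\lambda))_{sa}=(1-\gamma)\Big(1+\log\frac{(1-\gamma)\lambda_{sa}}{\mu_{sa}}\Big),$$ and let $\sigma$ be such that $\|\nabla\rho(\lambda)\|_\infty\le\sigma$ for all $\lambda\in\mathcal L$ with $\lambda\ge\delta_0\mathbf 1$. Let $c>0$ and let $\lambda^*$ be an optimal solution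 of $$\max_{\lambda\ge0}\ \langle\lambda,r\rangle-c\rho(\lambda)\quad\text{s.t.}\quad \sum_{a}(I-\gamma P_a^\top)\lambda_a=\xi,\quad \|\lambda\|_1=(1-\gamma)^{-1}.$$ Algorithm. Put $\mathcal V=\{v\in\mathbb R^{\mathcal S}:\|v\|_\infty\le 2\frac{1+c\sigma}{1-\gamma}\}$. Start from an arbitrary $v^1\in\mathcal V$ and $\lambda^1=\frac{1}{|\mathcal S||\mathcal A|(1-\gamma)}\mathbf 1$. For $t=1,\dots,T$: set $\zeta^t=(1-\delta)(1-\gamma)\lambda^t+\frac{\delta}{|\mathcal S||\mathcal A|}\mathbf 1$; given the past, draw $(s_t,a_t)\sim\zeta^t$, $s'_t\sim P_{a_t}(s_t,\cdot)$ and, independently, $\bar s_t\sim\xi$; put $$g^t=\mathbf e_{\bar s_t}+\frac{\lambda^t_{s_ta_t}}{\zeta^t_{s_ta_t}}(\gamma\mathbf e_{s'_t}-\mathbf e_{s_t}),\qquad \Delta^t=\frac{\hat r_{s_ts'_ta_t}+\gamma v^t_{s'_t}-v^t_{s_t}-M_1}{\zeta^t_{s_ta_t}}\mathbf E_{s_ta_t}-c\nabla\rho(\lambda^t)-M_2\mathbf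 1,$$ where $\mathbf e$ and $\mathbf E$ denote coordinate vectors; and update, with $\Pi_{\mathcal V}$ the Euclidean projection onto $\mathcal V$, $$v^{t+1}=\Pi_{\mathcal V}(v^t-\alpha g^t),\qquad \lambda^{t+\frac12}=\operatorname*{argmax}_{\lambda\ge0}\ \langle\Delta^t,\lambda-\lambda^t\rangle-\tfrac{1}{(1-\gamma)\beta}KL\big((1-\gamma)\lambda\,\|\,(1-\gamma)\lambda^t\big),\qquad \lambda^{t+1}=\frac{\lambda^{t+\frac12}}{(1-\gamma)\|\lambda^{t+\frac12}\|_1}.$$ The output is $\bar\lambda=\frac1T\sum_{t=1}^T\lambda^t$. The parameters are $M_1=\frac{4(1+c\sigma)}{1-\gamma}$, $M_2=c\sigma$, $\delta\in(0,\frac12)$, $\beta=\frac{1-\gamma}{1+c\sigma}\sqrt{\frac{\log(|\mathcal S||\mathcal A|)}{T|\mathcal S||\mathcal A|}}$, $\alpha=\sqrt{\frac{|\mathcal S|}{T}}\,(1+c\sigma)$. Claim. There is a universal constant $C>0$ (independent of all the data above) such that for every $\varepsilon>0$ and every integer $$T\ \ge\ C\,\frac{|\mathcal S||\mathcal A|\log(|\mathcal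 S||\mathcal A|)(1+2c\sigma)^2}{(1-\gamma)^4\varepsilon^2},$$ every coordinate of $\lambda^*$ is positive (so the divergence below is finite) and $$\mathbb E\big[KL\big((1-\gamma)\bar\lambda\,\|\,(1-\gamma)\lambda^*\big)\big]\le\frac{\varepsilon}{c}.$$ -/

import Mathlib

namespace CautiousRL

noncomputable section

/-- A discounted Markov decision process with finite state space `S` and action space `A`.
`P a i j` is the probability of moving from `i` to `j` under the action `a`, and `rew i j a` in
`[0,1]` is the reward revealed on that transition. -/
structure MDP (S A : Type*) [Fintype S] where
  P : A → S → S → ℝ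
  P_nonneg : ∀ a i j, 0 ≤ P a i j
  P_sum : ∀ a i, ∑ j, P a i j = 1
  rew : S → S → A → ℝ
  rew_nonneg : ∀ i j a, 0 ≤ rew i j a
  rew_le_one : ∀ i j a, rew i j a ≤ 1
  γ : ℝ
  γ_pos : 0 < γ
  γ_lt_one : γ < 1

/-- `KL(p ‖ q) = ∑ i, p i * log (p i / q i)` for nonnegative vectors, with `0 log 0 = 0`.
It is only used where `q` is positive in every coordinate. -/
def kl {ι : Type*} [Fintype ι] (p q : ι → ℝ) : ℝ :=
  ∑ i, p i * Real.log (p i / q i)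

variable {S A : Type*} [Fintype S] [Fintype A]

/-- The expected one-step reward `r_{ia}`. -/
def MDP.expRew (M : MDP S A) (x : S × A) : ℝ :=
  ∑ j, M.P x.2 x.1 j * M.rew x.1 j x.2

/-- The uniform initial distribution `ξ` on the states. -/
def xi (S : Type*) [Fintype S] (_s : S) : ℝ := 1 / (Fintype.card S : ℝ)

/-- The set `𝓛` of nonnegative `lam` with `‖lam‖₁ = (1 - γ)⁻¹`. -/
def dualRegion (M : MDP S A) : Set (S × A → ℝ) :=
  {lam | (∀ x, 0 ≤ lam x) ∧ ∑ x, |lam x| = (1 - M.γ)⁻¹}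

/-- Feasibility for the cautious policy optimization problem: `lam ≥ 0`,
`∑ a, (I - γ P_aᵀ) lam_a = ξ` and `‖lam‖₁ = (1 - γ)⁻¹`. -/
def feasible (M : MDP S A) : Set (S × A → ℝ) :=
  {lam | lam ∈ dualRegion M ∧
    ∀ j, ∑ a, (lam (j, a) - M.γ * ∑ i, M.P a i j * lam (i, a)) = xi S j}

/-- The caution `ρ(lam) = KL((1 - γ) lam ‖ μ)`. -/
def caution (M : MDP S A) (μ lam : S × A → ℝ) : ℝ :=
  kl (fun x => (1 - M.γ) * lam x) μ

/-- The gradient of the caution with respect to `lam`. -/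
def cautionGrad (M : MDP S A) (μ lam : S × A → ℝ) (x : S × A) : ℝ :=
  (1 - M.γ) * (1 + Real.log ((1 - M.γ) * lam x / μ x))

/-- `cautionGrad` is indeed the gradient of `caution` at every positive `lam`. -/
theorem hasFDerivAt_caution (M : MDP S A) (μ lam : S × A → ℝ) (hμ : ∀ x, 0 < μ x)
    (hlam : ∀ x, 0 < lam x) :
    HasFDerivAt (caution M μ)
      (∑ x, cautionGrad M μ lam x • (ContinuousLinearMap.proj x : (S × A → ℝ) →L[ℝ] ℝ)) lam := by
  have hg : 0 < 1 - M.γ := sub_pos.2 M.γ_lt_one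
  unfold caution kl
  apply HasFDerivAt.fun_sum
  intro x _
  have h1 : HasDerivAt
      (fun y : ℝ => (1 - M.γ) * y * Real.log ((1 - M.γ) * y / μ x))
      (cautionGrad M μ lam x) (lam x) := by
    have hne : (1 - M.γ) * lam x / μ x ≠ 0 :=
      (div_pos (mul_pos hg (hlam x)) (hμ x)).ne'
    have ha : HasDerivAt (fun y : ℝ => (1 - M.γ) * y) (1 - M.γ) (lam x) := by
      simpa using (hasDerivAt_id (lam x)).const_mul (1 - M.γ)
    have hb := (ha.div_const (μ x)).log hne
    have hc := ha.mul hb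
    refine hc.congr_deriv ?_
    have := (hlam x).ne'
    have := (hμ x).ne'
    have := hg.ne'
    unfold cautionGrad
    field_simp
    ring
  exact h1.comp_hasFDerivAt lam
    (ContinuousLinearMap.proj (R := ℝ) (φ := fun _ : S × A => ℝ) x).hasFDerivAt

/-- `lam` solves `max ⟨lam, r⟩ - c ρ(lam)` over the feasible set. -/
def IsOptimal (M : MDP S A) (c : ℝ) (μ lam : S × A → ℝ) : Prop :=
  lam ∈ feasible M ∧
    IsMaxOn (fun l : S × A → ℝ => ∑ x, l x * M.expRew x - c * caution M μ l) (feasible M) lam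

/-- The numerical inputs of the algorithm: penalty `c`, gradient bound `σ`, exploration
parameter `δ`, step sizes `α`, `β` and shift parameters `M₁`, `M₂`. -/
structure Params where
  c : ℝ
  σ : ℝ
  δ : ℝ
  α : ℝ
  β : ℝ
  M₁ : ℝ
  M₂ : ℝ

/-- The feasible region `𝓥 = {v : ‖v‖_∞ ≤ 2 (1 + c σ) / (1 - γ)}`. -/
def valueRegion (M : MDP S A) (c σ : ℝ) : Set (S → ℝ) :=
  {v | ∀ s, |v s| ≤ 2 * ((1 + c * σ) / (1 - M.γ))}

/-- The Euclidean projection onto a set of vectors: a point of `V` at least distance. -/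
def project (V : Set (S → ℝ)) (v : S → ℝ) : S → ℝ :=
  Classical.epsilon fun w => w ∈ V ∧ IsMinOn (fun u : S → ℝ => ∑ s, (u s - v s) ^ 2) V w

/-- The random data drawn in one iteration. -/
structure Sample (S A : Type*) where
  s : S
  a : A
  s' : S
  sbar : S

/-- A sample is the same thing as a tuple `(s, a, s', sbar)`. -/
def Sample.equiv (S A : Type*) : S × A × S × S ≃ Sample S A where
  toFun p := ⟨p.1, p.2.1, p.2.2.1, p.2.2.2⟩
  invFun x := (x.s, x.a, x.s', x.sbar)
  left_inv _ := rfl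
  right_inv _ := rfl

instance : Fintype (Sample S A) := Fintype.ofEquiv _ (Sample.equiv S A)

/-- The sampling distribution `ζ = (1 - δ)(1 - γ) lam + δ / (|S||A|)`. -/
def zeta (M : MDP S A) (δ : ℝ) (lam : S × A → ℝ) (x : S × A) : ℝ :=
  (1 - δ) * (1 - M.γ) * lam x + δ / ((Fintype.card S : ℝ) * (Fintype.card A : ℝ))

/-- The probability of the sample `(s, a, s', sbar)` when the current dual iterate is `lam`:
`(s, a) ∼ ζ`, `s' ∼ P(· | a, s)`, and independently `sbar ∼ ξ`. -/
def sampleProb (M : MDP S A) (δ : ℝ) (lam : S × A → ℝ) (z : Sample S A) : ℝ :=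
  zeta M δ lam (z.s, z.a) * M.P z.a z.s z.s' * xi S z.sbar

variable [DecidableEq S] [DecidableEq A]

/-- The stochastic gradient in `v`:
`e_sbar + 1_{ζ_{sa} > 0} (lam_{sa} / ζ_{sa}) (γ e_{s'} - e_s)`. -/
def gradV (M : MDP S A) (δ : ℝ) (lam : S × A → ℝ) (z : Sample S A) (i : S) : ℝ :=
  (Pi.single z.sbar 1 : S → ℝ) i +
    (if 0 < zeta M δ lam (z.s, z.a) then lam (z.s, z.a) / zeta M δ lam (z.s, z.a) else 0) *
      (M.γ * (Pi.single z.s' 1 : S → ℝ) i - (Pi.single z.s 1 : S → ℝ) i)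

/-- The shifted stochastic gradient in `lam`:
`1_{ζ_{sa} > 0} ((rew + γ v_{s'} - v_s - M₁) / ζ_{sa}) E_{sa} - c ∇ρ(lam) - M₂ 1`. -/
def gradLam (M : MDP S A) (μ : S × A → ℝ) (p : Params) (v : S → ℝ) (lam : S × A → ℝ)
    (z : Sample S A) (x : S × A) : ℝ :=
  (if 0 < zeta M p.δ lam (z.s, z.a) then
      (M.rew z.s z.s' z.a + M.γ * v z.s' - v z.s - p.M₁) / zeta M p.δ lam (z.s, z.a)
    else 0) * (Pi.single (z.s, z.a) 1 : S × A → ℝ) x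
  - p.c * cautionGrad M μ lam x - p.M₂

/-- The half step: a maximizer over `l ≥ 0` of
`⟨g, l - lam⟩ - KL((1 - γ) l ‖ (1 - γ) lam) / ((1 - γ) β)`. -/
def halfStep (M : MDP S A) (β : ℝ) (g lam : S × A → ℝ) : S × A → ℝ :=
  Classical.epsilon fun w =>
    w ∈ {l : S × A → ℝ | ∀ x, 0 ≤ l x} ∧
    IsMaxOn (fun l : S × A → ℝ => ∑ x, g x * (l x - lam x)
        - 1 / ((1 - M.γ) * β) * kl (fun x => (1 - M.γ) * l x) (fun x => (1 - M.γ) * lam x))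
      {l : S × A → ℝ | ∀ x, 0 ≤ l x} w

/-- Rescaling to `‖·‖₁ = (1 - γ)⁻¹`. -/
def rescale (M : MDP S A) (l : S × A → ℝ) (x : S × A) : ℝ :=
  l x / ((1 - M.γ) * ∑ y, |l y|)

/-- One iteration `(v, lam) ↦ (v⁺, lam⁺)` of the algorithm, given the sample `z`. -/
def step (M : MDP S A) (μ : S × A → ℝ) (p : Params) (q : (S → ℝ) × (S × A → ℝ))
    (z : Sample S A) : (S → ℝ) × (S × A → ℝ) :=
  (project (valueRegion M p.c p.σ) (fun s => q.1 s - p.α * gradV M p.δ q.2 z s),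
   rescale M (halfStep M p.β (gradLam M μ p q.1 q.2 z) q.2))

/-- The initial dual iterate, `1 / (|S||A|(1 - γ))` in every coordinate. -/
def initLam (M : MDP S A) (_x : S × A) : ℝ :=
  1 / ((Fintype.card S : ℝ) * (Fintype.card A : ℝ) * (1 - M.γ))

/-- The iterates `(v^t, lam^t)` as a function of the samples `z`; the indices `t = 0, 1, …`
here are the iterations `1, 2, …`, and `iterate t` reads the samples `z 0, …, z (t-1)` only. -/
def iterate (M : MDP S A) (μ : S × A → ℝ) (p : Params) (v₁ : S → ℝ) {T : ℕ}
    (z : Fin T → Sample S A) : ℕ → (S → ℝ) × (S × A → ℝ)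
  | 0 => (v₁, initLam M)
  | t + 1 =>
    if h : t < T then step M μ p (iterate M μ p v₁ z t) (z ⟨t, h⟩)
    else iterate M μ p v₁ z t

/-- The probability that the algorithm draws the samples `z` in its `T` iterations: each sample
has the law `sampleProb` of the current dual iterate, given the earlier ones. -/
def pathProb (M : MDP S A) (μ : S × A → ℝ) (p : Params) (v₁ : S → ℝ) {T : ℕ}
    (z : Fin T → Sample S A) : ℝ :=
  ∏ t : Fin T, sampleProb M p.δ (iterate M μ p v₁ z t).2 (z t)

/-- The output `(1/T) ∑ t, lam^t` of the algorithm. -/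
def output (M : MDP S A) (μ : S × A → ℝ) (p : Params) (v₁ : S → ℝ) {T : ℕ}
    (z : Fin T → Sample S A) (x : S × A) : ℝ :=
  1 / (T : ℝ) * ∑ t : Fin T, (iterate M μ p v₁ z t).2 x

/-- The expectation of `F (output)` over the samples drawn in `T` iterations. -/
def expOutput (M : MDP S A) (μ : S × A → ℝ) (p : Params) (v₁ : S → ℝ) (T : ℕ)
    (F : (S × A → ℝ) → ℝ) : ℝ :=
  ∑ z : Fin T → Sample S A, pathProb M μ p v₁ z * F (output M μ p v₁ z)

/-- The parameter choice `M₁ = 4 (1 + c σ) / (1 - γ)`, `M₂ = c σ`,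
`β = (1 - γ) / (1 + c σ) * √(log (|S||A|) / (T |S||A|))`, `α = √(|S| / T) (1 + c σ)`. -/
def chosenParams (M : MDP S A) (c σ δ : ℝ) (T : ℕ) : Params where
  c := c
  σ := σ
  δ := δ
  α := Real.sqrt ((Fintype.card S : ℝ) / T) * (1 + c * σ)
  β := (1 - M.γ) / (1 + c * σ) *
    Real.sqrt (Real.log ((Fintype.card S : ℝ) * (Fintype.card A : ℝ)) /
      (T * ((Fintype.card S : ℝ) * (Fintype.card A : ℝ))))
  M₁ := 4 * (1 + c * σ) / (1 - M.γ)
  M₂ := c * σ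

end

end CautiousRL

/-! The problem is a saddle point in `(v, lam)`, with `v` the multiplier of the flow constraint.
Since `caution` is a relative entropy, its Bregman divergence is a relative entropy too: at an
optimal multiplier, the Lagrangian gap of a positive `lam` of the right mass is exactly `c` times
the divergence from `lam` to `lamStar` (`mul_kl_eq_gap`). It therefore suffices to bound the summed
gap along the iterates; convexity passes to their average.

The algorithm is projected stochastic gradient descent in `v` and entropic mirror ascent in `lam`.
The `potential`, a scaled divergence plus a scaled squared distance to the saddle point, decreases
in expectation by the gap, up to `stepError` (`expect_potential_step_le`). Telescoping along the
path (`expect_path_le`) and inserting the step sizes gives the rate.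

The delicate point is that `σ` bounds the gradient only where `lam ≥ δ₀`, which neither the iterates
nor `lamStar` need satisfy. In the mirror step the entropic part is therefore separated from the
sampled gain (`kl_mirror_step_le`): its first-order part is a difference of cautions minus a
divergence that can be dropped, and its second-order part is controlled by `entropy_second_order_le`
using only a bound on `(1 - γ) log (1 / μ)` of order `σ √(|S||A|)` (`mul_log_inv_le`). In the bound
on the multiplier (`abs_multiplier_le`), the state marginals of `lamStar`, which the flow constraint
keeps away from zero, take the place of its coordinates. -/

namespace CautiousRL

noncomputable section

/-! ### Scalar inequalities for the exponential, the logarithm and KL. -/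

section

variable {S A : Type*} [Fintype S] [Fintype A]

/-- Follows from the lower bound for `exp (-x)`, because `(1 + x + x²/2)(1 - x + x²/2) = 1 + x⁴/4 ≥
1`. -/
theorem exp_le_quadratic_of_nonpos {x : ℝ} (hx : x ≤ 0) :
    Real.exp x ≤ 1 + x + x ^ 2 / 2 := by
  have h := Real.quadratic_le_exp_of_nonneg (neg_nonneg.2 hx)
  have h1 : Real.exp x * Real.exp (-x) = 1 := by rw [← Real.exp_add]; simp
  have h2 := Real.exp_pos x
  have h3 : 0 < 1 + x + x ^ 2 / 2 := by nlinarith [sq_nonneg (x + 1)]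
  have h4 : 0 < 1 + -x + (-x) ^ 2 / 2 := by nlinarith
  have h5 : Real.exp x * (1 + -x + (-x) ^ 2 / 2) ≤ 1 := by
    exact (mul_le_mul_of_nonneg_left h h2.le).trans_eq h1
  have h6 : 1 ≤ (1 + x + x ^ 2 / 2) * (1 + -x + (-x) ^ 2 / 2) := by
    nlinarith [sq_nonneg (x ^ 2)]
  exact le_of_mul_le_mul_right (h5.trans h6) h4

theorem exp_le_of_nonneg {x : ℝ} (hx : 0 ≤ x) :
    Real.exp x ≤ 1 + x + x ^ 2 * Real.exp x := by
  have h2 := Real.exp_pos x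
  rcases le_or_gt 1 x with h | h
  · nlinarith [mul_le_mul_of_nonneg_right (one_le_pow₀ h : (1 : ℝ) ≤ x ^ 2) h2.le]
  · have h1 : Real.exp x * Real.exp (-x) = 1 := by rw [← Real.exp_add]; simp
    have h3 := Real.add_one_le_exp (-x)
    have h4 : Real.exp x * (1 - x) ≤ 1 := by
      rw [← h1]; exact mul_le_mul_of_nonneg_left (by linarith) h2.le
    nlinarith [mul_le_mul_of_nonneg_right h4 (by linarith : (0 : ℝ) ≤ 1 + x)]

/-- Here `a` is the sampled gain, which may be huge but has a sign, and `b` the entropic term. If `a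
+ b > 0` then `a + b ≤ b`, so the whole remainder is charged to `b` and no exponential of the gain's
size appears. -/
theorem exp_add_le_quadratic {a b : ℝ} (ha : a ≤ 0) :
    Real.exp (a + b) ≤ 1 + a + b + a ^ 2 + b ^ 2 * max 1 (Real.exp b) := by
  have hm1 : b ^ 2 ≤ b ^ 2 * max 1 (Real.exp b) :=
    le_mul_of_one_le_right (sq_nonneg b) (le_max_left _ _)
  rcases le_or_gt (a + b) 0 with h | h
  · have := exp_le_quadratic_of_nonpos h
    nlinarith [sq_nonneg (a - b)]
  · have h1 := exp_le_of_nonneg h.le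
    have h2 : (a + b) ^ 2 * Real.exp (a + b) ≤ b ^ 2 * max 1 (Real.exp b) := by
      apply mul_le_mul
      · exact pow_le_pow_left₀ h.le (by linarith) 2
      · exact (Real.exp_le_exp.2 (by linarith)).trans (le_max_right _ _)
      · exact (Real.exp_pos _).le
      · exact sq_nonneg b
    nlinarith [sq_nonneg a]

/-- The second-order term of the entropy in a mirror step, bounded without a lower bound on `p`. -/
theorem entropy_second_order_le {p m η G D : ℝ} (hp : 0 < p) (hp1 : p ≤ 1) (hm : 0 < m)
    (hη : 0 ≤ η) (hη' : η ≤ 3 / 4) (hG : 0 < G) (hD : G * Real.log (1 / m) ≤ D) :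
    G ^ 2 * (p * Real.log (p / m) ^ 2 * max 1 (Real.exp (-η * Real.log (p / m)))) ≤
      32 * G ^ 2 * m + D ^ 2 * p := by
  have hy : 0 < p / m := div_pos hp hm
  set l := Real.log (p / m) with hl
  have hpl : p = m * Real.exp l := by rw [hl, Real.exp_log hy]; field_simp
  -- Where `p ≥ m`, `p ≤ 1` gives `l ≤ log (1 / m)`. Where `p < m`, the factor `exp l` inside `p`
  -- absorbs both `exp (-3l/4)` and `l² ≤ 32 exp (-l/4)`, leaving `32 m`.
  rcases le_or_gt 0 l with h0 | h0
  · rw [max_eq_left (Real.exp_le_one_iff.2 (by nlinarith))]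
    have h1 : l ≤ Real.log (1 / m) := by
      rw [hl]; exact Real.log_le_log hy (by gcongr)
    have h2 : (G * l) ^ 2 ≤ D ^ 2 :=
      pow_le_pow_left₀ (by positivity) ((mul_le_mul_of_nonneg_left h1 hG.le).trans hD) 2
    have h3 := mul_le_mul_of_nonneg_right h2 hp.le
    have h4 : 0 ≤ 32 * G ^ 2 * m := by positivity
    nlinarith
  · rw [max_eq_right (Real.one_le_exp (by nlinarith))]
    have h1 : Real.exp (-η * l) ≤ Real.exp (-(3 / 4) * l) :=
      Real.exp_le_exp.2 (by nlinarith)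
    have h2 := Real.quadratic_le_exp_of_nonneg (x := -l / 4) (by linarith)
    have h3 : l ^ 2 ≤ 32 * Real.exp (-l / 4) := by nlinarith
    have h4 : p * l ^ 2 * Real.exp (-η * l) ≤ 32 * m := by
      calc p * l ^ 2 * Real.exp (-η * l)
          ≤ p * (32 * Real.exp (-l / 4)) * Real.exp (-(3 / 4) * l) := by gcongr
        _ = 32 * m * (Real.exp l * Real.exp (-l / 4) * Real.exp (-(3 / 4) * l)) := by
            rw [hpl]; ring
        _ = 32 * m := by
            rw [← Real.exp_add, ← Real.exp_add]
            ring_nf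
            simp
    have h5 : 0 ≤ D ^ 2 * p := by positivity
    nlinarith [mul_le_mul_of_nonneg_left h4 (sq_nonneg G)]

theorem sub_le_mul_log_div {p q : ℝ} (hp : 0 ≤ p) (hq : 0 < q) :
    p - q ≤ p * Real.log (p / q) := by
  rcases hp.eq_or_lt with rfl | hp
  · simp [hq.le]
  · have h := Real.one_sub_inv_le_log_of_pos (div_pos hp hq)
    have := mul_le_mul_of_nonneg_left h hp.le
    calc p - q = p * (1 - (p / q)⁻¹) := by field_simp
      _ ≤ _ := this

/-- The equality case of `sub_le_mul_log_div`; it makes the maximizer in `halfStep` unique. -/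
theorem eq_of_mul_log_div_le {p q : ℝ} (hp : 0 ≤ p) (hq : 0 < q)
    (h : p * Real.log (p / q) ≤ p - q) : p = q := by
  rcases hp.eq_or_lt with rfl | hp
  · simp at h; linarith
  · by_contra hne
    have h1 : q / p ≠ 1 := fun h' => hne ((div_eq_one_iff_eq hp.ne').1 h').symm
    have h2 := Real.log_lt_sub_one_of_pos (div_pos hq hp) h1
    have h3 : Real.log (p / q) = -Real.log (q / p) := by
      rw [← Real.log_inv, inv_div]
    have h4 := mul_lt_mul_of_pos_left h2 hp
    rw [h3] at h
    have : p * (q / p - 1) = q - p := by field_simp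
    linarith

theorem kl_nonneg {ι : Type*} [Fintype ι] {p q : ι → ℝ} (hp : ∀ i, 0 ≤ p i) (hq : ∀ i, 0 < q i)
    (h : ∑ i, p i = ∑ i, q i) : 0 ≤ kl p q := by
  have : ∑ i, (p i - q i) ≤ kl p q :=
    Finset.sum_le_sum fun i _ => sub_le_mul_log_div (hp i) (hq i)
  rw [Finset.sum_sub_distrib, h] at this
  linarith

theorem log_le_half {x : ℝ} (hx : 0 < x) : Real.log x ≤ x / 2 := by
  have h := Real.log_le_sub_one_of_pos (Real.sqrt_pos.2 hx)
  rw [Real.log_sqrt hx.le] at h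
  nlinarith [sq_nonneg (Real.sqrt x - 2), Real.sq_sqrt hx.le]

theorem one_add_log_le {x : ℝ} (hx : 0 < x) : 1 + Real.log x ≤ 2 * Real.sqrt x := by
  have h := Real.log_le_sub_one_of_pos (Real.sqrt_pos.2 hx)
  rw [Real.log_sqrt hx.le] at h
  linarith

theorem MDP.one_sub_pos {S A : Type*} [Fintype S] (M : MDP S A) : 0 < 1 - M.γ := sub_pos.2 M.γ_lt_one

theorem sum_eq_of_mem_dualRegion {M : MDP S A} {lam : S × A → ℝ} (h : lam ∈ dualRegion M) :
    ∑ x, lam x = (1 - M.γ)⁻¹ := by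
  rw [← h.2]
  exact Finset.sum_congr rfl fun x _ => (abs_of_nonneg (h.1 x)).symm

/-! ### Consequences of the gradient bound `σ` for the prior. -/

section GradientBound

variable {M : MDP S A} {μ : S × A → ℝ} {σ δ₀ : ℝ}

theorem card_mul_le_one (hμ : ∀ x, δ₀ ≤ μ x) (hμ1 : ∑ x, μ x = 1) :
    (Fintype.card S : ℝ) * Fintype.card A * δ₀ ≤ 1 := by
  rw [← hμ1]
  calc _ = ∑ _x : S × A, δ₀ := by simp
    _ ≤ _ := Finset.sum_le_sum fun x _ => hμ x

/-- Test vector: `τ` at `x`, the remaining mass spread evenly over the other pairs. The second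
condition on `τ` says that each of these receives at least `δ₀`. -/
theorem abs_grad_le (hn : 2 ≤ Fintype.card S * Fintype.card A) (hδ₀ : 0 < δ₀)
    (hσ : ∀ lam ∈ dualRegion M, (∀ x, δ₀ ≤ lam x) → ∀ x, |cautionGrad M μ lam x| ≤ σ)
    (x : S × A) {τ : ℝ} (h1 : δ₀ ≤ τ)
    (h2 : τ + ((Fintype.card S : ℝ) * Fintype.card A - 1) * δ₀ ≤ (1 - M.γ)⁻¹) :
    |(1 - M.γ) * (1 + Real.log ((1 - M.γ) * τ / μ x))| ≤ σ := by
  classical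
  set n : ℝ := (Fintype.card S : ℝ) * Fintype.card A with hnn
  have hn' : (2 : ℝ) ≤ n := by rw [hnn]; exact_mod_cast hn
  set lam : S × A → ℝ := fun y => if y = x then τ else ((1 - M.γ)⁻¹ - τ) / (n - 1) with hlam
  have hge : ∀ y, δ₀ ≤ lam y := by
    intro y
    simp only [hlam]
    split_ifs
    · exact h1
    · rw [le_div_iff₀ (by linarith)]; linarith
  have hsum : ∑ y, lam y = (1 - M.γ)⁻¹ := by
    have hc : ((Finset.univ.erase x).card : ℝ) = n - 1 := by
      rw [Finset.card_erase_of_mem (Finset.mem_univ x), Finset.card_univ, Fintype.card_prod,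
        Nat.cast_sub (by omega)]
      simp [hnn]
    rw [← Finset.add_sum_erase _ _ (Finset.mem_univ x)]
    have : ∑ y ∈ Finset.univ.erase x, lam y
        = ∑ y ∈ Finset.univ.erase x, ((1 - M.γ)⁻¹ - τ) / (n - 1) :=
      Finset.sum_congr rfl fun y hy => by simp [hlam, Finset.ne_of_mem_erase hy]
    rw [this, Finset.sum_const, nsmul_eq_mul, hc]
    simp only [hlam, if_true]
    have : n - 1 ≠ 0 := by linarith
    field_simp
    ring
  have hmem : lam ∈ dualRegion M := by
    refine ⟨fun y => hδ₀.le.trans (hge y), ?_⟩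
    rw [← hsum]
    exact Finset.sum_congr rfl fun y _ => abs_of_nonneg (hδ₀.le.trans (hge y))
  have := hσ lam hmem hge x
  simpa [cautionGrad, hlam] using this

theorem one_sub_le_gradBound (hn : 2 ≤ Fintype.card S * Fintype.card A) (hδ₀ : 0 < δ₀)
    (hμ : ∀ x, δ₀ ≤ μ x) (hμ1 : ∑ x, μ x = 1)
    (hσ : ∀ lam ∈ dualRegion M, (∀ x, δ₀ ≤ lam x) → ∀ x, |cautionGrad M μ lam x| ≤ σ) :
    1 - M.γ ≤ σ := by
  have hG := M.one_sub_pos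
  have hne : Nonempty (S × A) := by
    rw [← Fintype.card_pos_iff, Fintype.card_prod]; omega
  obtain ⟨x⟩ := hne
  -- At the rescaled prior the logarithm vanishes and the gradient is the constant `1 - γ`.
  have hmem : (fun x => μ x / (1 - M.γ)) ∈ dualRegion M := by
    have h0 : ∀ x, 0 ≤ μ x / (1 - M.γ) := fun x => div_nonneg (hδ₀.le.trans (hμ x)) hG.le
    refine ⟨h0, ?_⟩
    rw [Finset.sum_congr rfl fun y _ => abs_of_nonneg (h0 y), ← Finset.sum_div, hμ1, one_div]
  have := hσ _ hmem (fun y => (hμ y).trans ?_) x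
  · have hx := (hδ₀.trans_le (hμ x)).ne'
    simp only [cautionGrad] at this
    rw [mul_div_cancel₀ _ hG.ne', div_self hx] at this
    simpa [abs_of_pos hG] using this
  · rw [le_div_iff₀ hG]
    nlinarith [hδ₀.trans_le (hμ y), M.γ_pos]

/-- Uses the largest admissible `τ`, which leaves `δ₀` on every other pair; `|S||A| δ₀ ≤ 1` then
removes `δ₀` from the condition on `m`. -/
theorem mul_one_add_log_le (hn : 2 ≤ Fintype.card S * Fintype.card A) (hδ₀ : 0 < δ₀)
    (hμ : ∀ x, δ₀ ≤ μ x) (hμ1 : ∑ x, μ x = 1)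
    (hσ : ∀ lam ∈ dualRegion M, (∀ x, δ₀ ≤ lam x) → ∀ x, |cautionGrad M μ lam x| ≤ σ)
    (x : S × A) {m : ℝ} (hm0 : 0 < m)
    (hm : m ≤ 1 - (1 - M.γ) + (1 - M.γ) / ((Fintype.card S : ℝ) * Fintype.card A)) :
    (1 - M.γ) * (1 + Real.log (m / μ x)) ≤ σ := by
  have hG := M.one_sub_pos
  set n : ℝ := (Fintype.card S : ℝ) * Fintype.card A with hnn
  have hn' : (2 : ℝ) ≤ n := by rw [hnn]; exact_mod_cast hn
  have hc : n * δ₀ ≤ 1 := card_mul_le_one hμ hμ1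
  have hx := hδ₀.trans_le (hμ x)
  have h1G : 1 ≤ (1 - M.γ)⁻¹ := (one_le_inv₀ hG).2 (by linarith [M.γ_pos])
  have h := abs_grad_le hn hδ₀ hσ x (τ := (1 - M.γ)⁻¹ - (n - 1) * δ₀) (by linarith) (by linarith)
  have hle : m ≤ (1 - M.γ) * ((1 - M.γ)⁻¹ - (n - 1) * δ₀) := by
    rw [mul_sub, mul_inv_cancel₀ hG.ne']
    have : δ₀ ≤ 1 / n := by rw [le_div_iff₀ (by linarith)]; linarith
    have h2 : (n - 1) * δ₀ ≤ 1 - 1 / n := by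
      calc (n - 1) * δ₀ ≤ (n - 1) * (1 / n) := by gcongr; linarith
        _ = 1 - 1 / n := by field_simp
    have h3 := mul_le_mul_of_nonneg_left h2 hG.le
    have h4 : (1 - M.γ) * (1 - 1 / n) = (1 - M.γ) - (1 - M.γ) / n := by ring
    linarith
  calc (1 - M.γ) * (1 + Real.log (m / μ x))
      ≤ (1 - M.γ) * (1 + Real.log ((1 - M.γ) * ((1 - M.γ)⁻¹ - (n - 1) * δ₀) / μ x)) := by
        gcongr
    _ ≤ σ := (le_abs_self _).trans h

/-- With `m = 1 / n`, the bound costs an extra `log n`, and `1 + log n ≤ 2 √n`. After squaring, this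
is linear in `n`, the same order as the sampling variance. -/
theorem mul_log_inv_le (hn : 2 ≤ Fintype.card S * Fintype.card A) (hδ₀ : 0 < δ₀)
    (hμ : ∀ x, δ₀ ≤ μ x) (hμ1 : ∑ x, μ x = 1)
    (hσ : ∀ lam ∈ dualRegion M, (∀ x, δ₀ ≤ lam x) → ∀ x, |cautionGrad M μ lam x| ≤ σ)
    (x : S × A) :
    (1 - M.γ) * Real.log (1 / μ x) ≤
      σ * (2 * Real.sqrt ((Fintype.card S : ℝ) * Fintype.card A)) := by
  have hG := M.one_sub_pos
  have hGσ := one_sub_le_gradBound hn hδ₀ hμ hμ1 hσ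
  set n : ℝ := (Fintype.card S : ℝ) * Fintype.card A with hnn
  have hn' : (2 : ℝ) ≤ n := by rw [hnn]; exact_mod_cast hn
  have hx := hδ₀.trans_le (hμ x)
  have h := mul_one_add_log_le hn hδ₀ hμ hμ1 hσ x (m := 1 / n) (by positivity) (by
    rw [← hnn]
    have : 1 / n ≤ 1 := by rw [div_le_one (by linarith)]; linarith
    have h2 : (1 - M.γ) / n = 1 / n - M.γ * (1 / n) := by ring
    nlinarith [M.γ_pos])
  have h2 : Real.log (1 / n / μ x) = Real.log (1 / μ x) - Real.log n := by
    rw [div_right_comm, Real.log_div (by positivity) (by positivity)]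
  rw [h2] at h
  have h3 := one_add_log_le (x := n) (by linarith)
  have h4 : 0 ≤ Real.log n := Real.log_nonneg (by linarith)
  nlinarith [mul_le_mul_of_nonneg_right hGσ h4,
    mul_le_mul_of_nonneg_left h3 (hG.le.trans hGσ)]

theorem neg_gradBound_le (hn : 2 ≤ Fintype.card S * Fintype.card A) (hδ₀ : 0 < δ₀)
    (hμ : ∀ x, δ₀ ≤ μ x) (hμ1 : ∑ x, μ x = 1)
    (hσ : ∀ lam ∈ dualRegion M, (∀ x, δ₀ ≤ lam x) → ∀ x, |cautionGrad M μ lam x| ≤ σ)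
    (x : S × A) {m : ℝ}
    (hm : (1 - M.γ) / ((Fintype.card S : ℝ) * Fintype.card A) ≤ m) :
    -σ ≤ (1 - M.γ) * (1 + Real.log (m / μ x)) := by
  have hG := M.one_sub_pos
  set n : ℝ := (Fintype.card S : ℝ) * Fintype.card A with hnn
  have hn' : (2 : ℝ) ≤ n := by rw [hnn]; exact_mod_cast hn
  have hc : n * δ₀ ≤ 1 := card_mul_le_one hμ hμ1
  have hx := hδ₀.trans_le (hμ x)
  have h1G : 1 ≤ (1 - M.γ)⁻¹ := (one_le_inv₀ hG).2 (by linarith [M.γ_pos])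
  have h := abs_grad_le hn hδ₀ hσ x (τ := δ₀) le_rfl (by linarith)
  have hle : (1 - M.γ) * δ₀ ≤ m := by
    refine le_trans ?_ hm
    rw [le_div_iff₀ (by linarith)]
    nlinarith
  calc -σ ≤ (1 - M.γ) * (1 + Real.log ((1 - M.γ) * δ₀ / μ x)) := (abs_le.1 h).1
    _ ≤ _ := by gcongr

/-- The state marginals of an occupancy measure obey the bound `σ` as well. -/
theorem abs_marginal_le (hn : 2 ≤ Fintype.card S * Fintype.card A) (hδ₀ : 0 < δ₀)
    (hμ : ∀ x, δ₀ ≤ μ x) (hμ1 : ∑ x, μ x = 1)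
    (hσ : ∀ lam ∈ dualRegion M, (∀ x, δ₀ ≤ lam x) → ∀ x, |cautionGrad M μ lam x| ≤ σ)
    (s : S) {m : ℝ} (hm1 : (1 - M.γ) / Fintype.card S ≤ m)
    (hm2 : m ≤ 1 - (1 - M.γ) + (1 - M.γ) / Fintype.card S) :
    |(1 - M.γ) * (1 + Real.log (m / ∑ a, μ (s, a)))| ≤ σ := by
  have hG := M.one_sub_pos
  have hS : 0 < Fintype.card S := Nat.pos_of_mul_pos_right (by omega : 0 < Fintype.card S * Fintype.card A)
  have hA : 0 < Fintype.card A := Nat.pos_of_mul_pos_left (by omega : 0 < Fintype.card S * Fintype.card A)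
  have hS' : (0 : ℝ) < Fintype.card S := by exact_mod_cast hS
  have hA' : (1 : ℝ) ≤ Fintype.card A := by exact_mod_cast hA
  have hne : Nonempty A := Fintype.card_pos_iff.1 hA
  set W := ∑ a, μ (s, a) with hW
  have hW0 : 0 < W := Finset.sum_pos (fun a _ => hδ₀.trans_le (hμ _)) Finset.univ_nonempty
  have hm0 : 0 < m := (by positivity : (0 : ℝ) < (1 - M.γ) / Fintype.card S).trans_le hm1
  have hsum : ∑ _a : A, W / Fintype.card A = W := by
    rw [Finset.sum_const, Finset.card_univ, nsmul_eq_mul]; field_simp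
  -- Averaging: `a` has at least the mean prior mass `W / |A|` and `b` at most. The ratio `m / W` is
  -- thus squeezed between ratios at single pairs carrying mass `m / |A|`.
  obtain ⟨a, -, ha⟩ := Finset.exists_le_of_sum_le (s := Finset.univ)
    (f := fun _ : A => W / Fintype.card A) (g := fun a => μ (s, a)) Finset.univ_nonempty hsum.le
  obtain ⟨b, -, hb⟩ := Finset.exists_le_of_sum_le (s := Finset.univ)
    (g := fun _ : A => W / Fintype.card A) (f := fun a => μ (s, a)) Finset.univ_nonempty hsum.ge
  have hpa := hδ₀.trans_le (hμ (s, a))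
  have hpb := hδ₀.trans_le (hμ (s, b))
  rw [abs_le]
  constructor
  · have h := neg_gradBound_le hn hδ₀ hμ hμ1 hσ (s, a) (m := m / Fintype.card A) (by
      rw [← div_div]; gcongr)
    refine h.trans ?_
    have : m / Fintype.card A / μ (s, a) ≤ m / W := by
      rw [div_div]
      gcongr
      rw [div_le_iff₀ (by positivity)] at ha
      linarith
    gcongr
  · have h := mul_one_add_log_le hn hδ₀ hμ hμ1 hσ (s, b) (m := m / Fintype.card A)
      (by positivity) (by
        rw [div_le_iff₀ (by positivity)]
        refine hm2.trans ?_
        rw [add_mul]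
        have : (1 - M.γ) / (Fintype.card S * Fintype.card A) * (Fintype.card A : ℝ)
          = (1 - M.γ) / Fintype.card S := by field_simp
        rw [this]
        have := M.γ_pos
        nlinarith)
    refine le_trans ?_ h
    have : m / W ≤ m / Fintype.card A / μ (s, b) := by
      rw [div_div]
      gcongr
      rw [le_div_iff₀ (by positivity)] at hb
      linarith
    gcongr

end GradientBound

end

/-! ### Flow constraint, optimality conditions and multipliers. -/

section

variable {S A : Type*} [Fintype S] [Fintype A]

/-- `v_i - γ ∑ j, P_a(i,j) v_j`, the adjoint of the flow operator `∑ a, (I - γ P_aᵀ) lam_a`. -/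
def MDP.bellman (M : MDP S A) (v : S → ℝ) (x : S × A) : ℝ :=
  v x.1 - M.γ * ∑ j, M.P x.2 x.1 j * v j

theorem sum_mul_bellman (M : MDP S A) (d : S × A → ℝ) (v : S → ℝ) :
    ∑ x, d x * M.bellman v x =
      ∑ j, v j * ∑ a, (d (j, a) - M.γ * ∑ i, M.P a i j * d (i, a)) := by
  have h1 : ∑ x, d x * M.bellman v x
      = ∑ i, ∑ a, d (i, a) * v i - ∑ i, ∑ a, ∑ j, M.γ * (M.P a i j * d (i, a)) * v j := by
    rw [Fintype.sum_prod_type, ← Finset.sum_sub_distrib]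
    refine Finset.sum_congr rfl fun i _ => ?_
    rw [← Finset.sum_sub_distrib]
    refine Finset.sum_congr rfl fun a _ => ?_
    simp only [MDP.bellman]
    rw [mul_sub, Finset.mul_sum, Finset.mul_sum]
    congr 1
    exact Finset.sum_congr rfl fun j _ => by ring
  have h2 : ∑ j, v j * ∑ a, (d (j, a) - M.γ * ∑ i, M.P a i j * d (i, a))
      = ∑ i, ∑ a, d (i, a) * v i - ∑ j, ∑ a, ∑ i, M.γ * (M.P a i j * d (i, a)) * v j := by
    rw [← Finset.sum_sub_distrib]
    refine Finset.sum_congr rfl fun i _ => ?_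
    rw [Finset.mul_sum, ← Finset.sum_sub_distrib]
    refine Finset.sum_congr rfl fun a _ => ?_
    rw [mul_sub, mul_comm, Finset.mul_sum, Finset.mul_sum]
    congr 1
    exact Finset.sum_congr rfl fun j _ => by ring
  rw [h1, h2]
  congr 1
  calc ∑ i, ∑ a, ∑ j, M.γ * (M.P a i j * d (i, a)) * v j
      = ∑ i, ∑ j, ∑ a, M.γ * (M.P a i j * d (i, a)) * v j :=
        Finset.sum_congr rfl fun i _ => Finset.sum_comm
    _ = ∑ j, ∑ i, ∑ a, M.γ * (M.P a i j * d (i, a)) * v j := Finset.sum_comm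
    _ = _ := Finset.sum_congr rfl fun i _ => Finset.sum_comm

theorem bellman_one {S A : Type*} [Fintype S] (M : MDP S A) (x : S × A) : M.bellman (fun _ => 1) x = 1 - M.γ := by
  simp [MDP.bellman, M.P_sum]

theorem sum_flow (M : MDP S A) (d : S × A → ℝ) :
    ∑ j, ∑ a, (d (j, a) - M.γ * ∑ i, M.P a i j * d (i, a)) = (1 - M.γ) * ∑ x, d x := by
  have h := sum_mul_bellman M d (fun _ => 1)
  simp only [bellman_one, one_mul] at h
  rw [← h, ← Finset.sum_mul, mul_comm]

theorem sum_xi [Nonempty S] : ∑ s, xi S s = 1 := by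
  simp [xi]

theorem sum_bellman_of_feasible {M : MDP S A} {lam : S × A → ℝ} (h : lam ∈ feasible M)
    (v : S → ℝ) : ∑ x, lam x * M.bellman v x = ∑ j, v j * xi S j := by
  rw [sum_mul_bellman]
  exact Finset.sum_congr rfl fun j _ => by rw [h.2 j]

/-- Summing the flow constraint over the states already fixes the total mass. -/
theorem feasible_of_flow [Nonempty S] {M : MDP S A} {lam : S × A → ℝ} (h0 : ∀ x, 0 ≤ lam x)
    (h : ∀ j, ∑ a, (lam (j, a) - M.γ * ∑ i, M.P a i j * lam (i, a)) = xi S j) :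
    lam ∈ feasible M := by
  refine ⟨⟨h0, ?_⟩, h⟩
  rw [Finset.sum_congr rfl fun x _ => abs_of_nonneg (h0 x)]
  have h1 := sum_flow M lam
  rw [Finset.sum_congr rfl fun j _ => h j, sum_xi] at h1
  exact eq_inv_of_mul_eq_one_right h1.symm

/-- A nonnegative vector dominated by `γ Qᵀ` applied to it, with `Q` stochastic, vanishes. -/
theorem eq_zero_of_le_discounted {Q : S → S → ℝ} {γ : ℝ} (hγ : γ < 1)
    (hQ : ∀ i, ∑ j, Q i j = 1) {f : S → ℝ} (hf : ∀ j, 0 ≤ f j)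
    (h : ∀ j, f j ≤ γ * ∑ i, Q i j * f i) (j : S) : f j = 0 := by
  have h1 : ∑ j, f j ≤ γ * ∑ j, f j := by
    calc ∑ j, f j ≤ ∑ j, γ * ∑ i, Q i j * f i := Finset.sum_le_sum fun j _ => h j
      _ = γ * ∑ i, ∑ j, Q i j * f i := by rw [← Finset.mul_sum, Finset.sum_comm]
      _ = γ * ∑ j, f j := by
        congr 1
        exact Finset.sum_congr rfl fun i _ => by rw [← Finset.sum_mul, hQ, one_mul]
  have h2 : 0 ≤ ∑ j, f j := Finset.sum_nonneg fun j _ => hf j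
  have h3 : ∑ j, f j = 0 := by nlinarith
  exact (Finset.sum_eq_zero_iff_of_nonneg fun j _ => hf j).1 h3 j (Finset.mem_univ j)

/-- The discounted occupancy measure of a stochastic matrix from a positive initial vector. -/
theorem exists_occupancy {Q : S → S → ℝ} {γ : ℝ} (hγ0 : 0 ≤ γ) (hγ : γ < 1)
    (hQ0 : ∀ i j, 0 ≤ Q i j) (hQ : ∀ i, ∑ j, Q i j = 1) {b : S → ℝ} (hb : ∀ j, 0 < b j) :
    ∃ d : S → ℝ, (∀ j, 0 < d j) ∧ ∀ j, d j - γ * ∑ i, Q i j * d i = b j := by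
  let K : (S → ℝ) →ₗ[ℝ] (S → ℝ) :=
    { toFun := fun d j => d j - γ * ∑ i, Q i j * d i
      map_add' := fun d e => by
        ext j
        simp only [Pi.add_apply, mul_add, Finset.sum_add_distrib]
        ring
      map_smul' := fun k d => by
        ext j
        simp only [Pi.smul_apply, smul_eq_mul, RingHom.id_apply, mul_sub, Finset.mul_sum]
        congr 1
        exact Finset.sum_congr rfl fun i _ => by ring }
  -- A kernel vector has `|d|` dominated by its discounted image, so it vanishes; in finite
  -- dimension injectivity gives solvability.
  have hinj : Function.Injective K := by
    rw [← LinearMap.ker_eq_bot, LinearMap.ker_eq_bot']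
    intro d hd
    have hd' : ∀ j, d j = γ * ∑ i, Q i j * d i := fun j => by
      have := congrFun hd j
      simp only [K, LinearMap.coe_mk, AddHom.coe_mk, Pi.zero_apply] at this
      linarith
    ext j
    refine abs_eq_zero.1 (eq_zero_of_le_discounted hγ hQ (f := fun j => |d j|)
      (fun j => abs_nonneg _) (fun j => ?_) j)
    calc |d j| = γ * |∑ i, Q i j * d i| := by
          conv_lhs => rw [hd' j, abs_mul, abs_of_nonneg hγ0]
      _ ≤ γ * ∑ i, Q i j * |d i| := by
          gcongr
          refine (Finset.abs_sum_le_sum_abs _ _).trans_eq ?_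
          exact Finset.sum_congr rfl fun i _ => by rw [abs_mul, abs_of_nonneg (hQ0 i j)]
  obtain ⟨d, hd⟩ := (LinearMap.injective_iff_surjective.1 hinj) b
  have hd' : ∀ j, d j - γ * ∑ i, Q i j * d i = b j := fun j => congrFun hd j
  -- The same domination argument, applied to the negative part of `d`.
  have hnn : ∀ j, 0 ≤ d j := by
    intro j
    have h0 := eq_zero_of_le_discounted hγ hQ (f := fun j => max (-d j) 0)
      (fun j => le_max_right _ _) (fun j => ?_) j
    · have := le_max_left (-d j) 0
      linarith
    · have h2 : -∑ i, Q i j * d i ≤ ∑ i, Q i j * max (-d i) 0 := by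
        rw [← Finset.sum_neg_distrib]
        refine Finset.sum_le_sum fun i _ => ?_
        rw [← mul_neg]
        exact mul_le_mul_of_nonneg_left (le_max_left _ _) (hQ0 i j)
      have h3 : 0 ≤ ∑ i, Q i j * max (-d i) 0 :=
        Finset.sum_nonneg fun i _ => mul_nonneg (hQ0 i j) (le_max_right _ _)
      refine max_le ?_ (mul_nonneg hγ0 h3)
      have := mul_le_mul_of_nonneg_left h2 hγ0
      linarith [hd' j, hb j]
  refine ⟨d, fun j => ?_, hd'⟩
  have h3 : 0 ≤ ∑ i, Q i j * d i :=
    Finset.sum_nonneg fun i _ => mul_nonneg (hQ0 i j) (hnn i)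
  nlinarith [hd' j, hb j, mul_nonneg hγ0 h3]

/-- The occupancy measure of the uniform policy. Its positivity supplies the interior point against
which `lamStar` is compared. -/
theorem exists_feasible_pos [Nonempty S] [Nonempty A] (M : MDP S A) :
    ∃ lam ∈ feasible M, ∀ x, 0 < lam x := by
  have hA : (0 : ℝ) < Fintype.card A := by exact_mod_cast Fintype.card_pos
  have hS : (0 : ℝ) < Fintype.card S := by exact_mod_cast Fintype.card_pos
  obtain ⟨d, hd0, hd⟩ := exists_occupancy (Q := fun i j => (∑ a, M.P a i j) / Fintype.card A)
    M.γ_pos.le M.γ_lt_one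
    (fun i j => div_nonneg (Finset.sum_nonneg fun a _ => M.P_nonneg a i j) hA.le)
    (fun i => by
      rw [← Finset.sum_div, Finset.sum_comm]
      simp [M.P_sum])
    (b := xi S) (fun j => by unfold xi; positivity)
  refine ⟨fun x => d x.1 / Fintype.card A, ?_, fun x => div_pos (hd0 _) hA⟩
  refine feasible_of_flow (fun x => (div_pos (hd0 _) hA).le) fun j => ?_
  rw [← hd j, Finset.sum_sub_distrib, ← Finset.mul_sum, Finset.sum_comm]
  congr 1
  · simp only [Finset.sum_const, Finset.card_univ, nsmul_eq_mul]
    field_simp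
  · congr 1
    refine Finset.sum_congr rfl fun i _ => ?_
    simp only
    rw [← Finset.sum_mul]
    ring

theorem convexOn_mul_log_div {m : ℝ} (hm : 0 < m) :
    ConvexOn ℝ (Set.Ici 0) fun y : ℝ => y * Real.log (y / m) := by
  have h : ConvexOn ℝ (Set.Ici 0) fun y : ℝ => y * Real.log y + (-Real.log m) * y :=
    Real.convexOn_mul_log.add ((LinearMap.mul ℝ ℝ (-Real.log m)).convexOn (convex_Ici 0))
  refine h.congr fun y hy => ?_
  rcases (show (0 : ℝ) ≤ y from hy).eq_or_lt with rfl | hy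
  · simp
  · simp only
    rw [Real.log_div hy.ne' hm.ne']
    ring

/-- The optimal occupancy measure has full support. -/
theorem IsOptimal.pos [Nonempty S] [Nonempty A] {M : MDP S A} {c : ℝ} {μ lamStar : S × A → ℝ}
    (hc : 0 < c) (hμ : ∀ x, 0 < μ x) (h : IsOptimal M c μ lamStar) (x₀ : S × A) :
    0 < lamStar x₀ := by
  have hG := M.one_sub_pos
  refine lt_of_le_of_ne (h.1.1.1 x₀) fun hx₀ => ?_
  obtain ⟨lam, hlam, hpos⟩ := exists_feasible_pos M
  set F : (S × A → ℝ) → ℝ := fun l => ∑ x, l x * M.expRew x - c * caution M μ l with hF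
  -- Move from `lamStar` a fraction `θ = exp (-K)` towards the interior point. A zero coordinate
  -- contributes `θ log θ = -θ K` to the entropy, an unbounded first-order gain that optimality
  -- forbids.
  have key : ∀ K : ℝ, 0 ≤ K → F lam + c * ((1 - M.γ) * lam x₀) * K ≤ F lamStar := by
    intro K hK
    set θ := Real.exp (-K) with hθ
    have hθ0 : 0 < θ := Real.exp_pos _
    have hθ1 : θ ≤ 1 := Real.exp_le_one_iff.2 (by linarith)
    have hf : (fun x => (1 - θ) * lamStar x + θ * lam x) ∈ feasible M := by
      refine feasible_of_flow (fun x => add_nonneg (mul_nonneg (by linarith) (h.1.1.1 x))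
        (mul_nonneg hθ0.le (hpos x).le)) fun j => ?_
      have e1 := h.1.2 j
      have e2 := hlam.2 j
      have : ∑ a, ((1 - θ) * lamStar (j, a) + θ * lam (j, a)
          - M.γ * ∑ i, M.P a i j * ((1 - θ) * lamStar (i, a) + θ * lam (i, a)))
          = (1 - θ) * ∑ a, (lamStar (j, a) - M.γ * ∑ i, M.P a i j * lamStar (i, a))
          + θ * ∑ a, (lam (j, a) - M.γ * ∑ i, M.P a i j * lam (i, a)) := by
        rw [Finset.mul_sum, Finset.mul_sum, ← Finset.sum_add_distrib]
        refine Finset.sum_congr rfl fun a _ => ?_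
        have : ∑ i, M.P a i j * ((1 - θ) * lamStar (i, a) + θ * lam (i, a))
            = (1 - θ) * ∑ i, M.P a i j * lamStar (i, a) + θ * ∑ i, M.P a i j * lam (i, a) := by
          rw [Finset.mul_sum, Finset.mul_sum, ← Finset.sum_add_distrib]
          exact Finset.sum_congr rfl fun i _ => by ring
        rw [this]; ring
      rw [this, e1, e2]; ring
    have hρ : caution M μ (fun x => (1 - θ) * lamStar x + θ * lam x) ≤
        (1 - θ) * caution M μ lamStar + θ * caution M μ lam
          - θ * ((1 - M.γ) * lam x₀) * K := by
      unfold caution kl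
      rw [Finset.mul_sum, Finset.mul_sum, ← Finset.sum_add_distrib, le_sub_iff_add_le]
      classical
      rw [← Finset.add_sum_erase _ _ (Finset.mem_univ x₀), add_right_comm]
      rw [← Finset.add_sum_erase (Finset.univ : Finset (S × A)) (fun x =>
        (1 - θ) * ((1 - M.γ) * lamStar x * Real.log ((1 - M.γ) * lamStar x / μ x)) +
        θ * ((1 - M.γ) * lam x * Real.log ((1 - M.γ) * lam x / μ x))) (Finset.mem_univ x₀)]
      refine add_le_add ?_ (Finset.sum_le_sum fun x _ => ?_)
      · have hp := mul_pos hG (hpos x₀)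
        have : Real.log ((1 - M.γ) * ((1 - θ) * 0 + θ * lam x₀) / μ x₀)
            = Real.log ((1 - M.γ) * lam x₀ / μ x₀) - K := by
          have : (1 - M.γ) * ((1 - θ) * 0 + θ * lam x₀) / μ x₀
              = θ * ((1 - M.γ) * lam x₀ / μ x₀) := by ring
          rw [this, Real.log_mul hθ0.ne' (div_pos hp (hμ x₀)).ne', hθ, Real.log_exp]
          ring
        simp only [← hx₀]
        rw [this]
        apply le_of_eq
        ring
      · have := (convexOn_mul_log_div (hμ x)).2 (x := (1 - M.γ) * lamStar x)
          (y := (1 - M.γ) * lam x) (mul_nonneg hG.le (h.1.1.1 x))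
          (mul_nonneg hG.le (hpos x).le) (by linarith : 0 ≤ 1 - θ) hθ0.le (by ring)
        simp only [smul_eq_mul] at this
        convert this using 2
        · ring
        · congr 2; ring
    have hopt : F (fun x => (1 - θ) * lamStar x + θ * lam x) ≤ F lamStar := h.2 hf
    have hlin : ∑ x, ((1 - θ) * lamStar x + θ * lam x) * M.expRew x
        = (1 - θ) * ∑ x, lamStar x * M.expRew x + θ * ∑ x, lam x * M.expRew x := by
      rw [Finset.mul_sum, Finset.mul_sum, ← Finset.sum_add_distrib]
      exact Finset.sum_congr rfl fun i _ => by ring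
    simp only [hF] at hopt ⊢
    rw [hlin] at hopt
    have h1 := mul_le_mul_of_nonneg_left hρ hc.le
    refine le_of_mul_le_mul_left ?_ hθ0
    linarith
  have ha : 0 < c * ((1 - M.γ) * lam x₀) := mul_pos hc (mul_pos hG (hpos x₀))
  have := key ((|F lamStar - F lam| + 1) / (c * ((1 - M.γ) * lam x₀))) (by positivity)
  rw [mul_div_cancel₀ _ ha.ne'] at this
  linarith [le_abs_self (F lamStar - F lam)]

/-- Lagrange multipliers for the flow constraint at the optimum. -/
theorem IsOptimal.exists_multiplier [Nonempty S] [Nonempty A] {M : MDP S A} {c : ℝ}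
    {μ lamStar : S × A → ℝ} (hc : 0 < c) (hμ : ∀ x, 0 < μ x) (h : IsOptimal M c μ lamStar) :
    ∃ v : S → ℝ, ∀ x, M.expRew x - c * cautionGrad M μ lamStar x = M.bellman v x := by
  classical
  have hpos := h.pos hc hμ
  let B : (S → ℝ) →ₗ[ℝ] (S × A → ℝ) :=
    { toFun := M.bellman
      map_add' := fun d e => by
        ext j
        simp only [MDP.bellman, Pi.add_apply, mul_add, Finset.sum_add_distrib]
        ring
      map_smul' := fun k d => by
        ext j
        simp only [MDP.bellman, Pi.smul_apply, smul_eq_mul, RingHom.id_apply, mul_sub,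
          Finset.mul_sum]
        congr 1
        exact Finset.sum_congr rfl fun i _ => by ring }
  set w : S × A → ℝ := fun x => M.expRew x - c * cautionGrad M μ lamStar x with hw
  suffices hmem : w ∈ LinearMap.range B by
    obtain ⟨v, hv⟩ := hmem
    exact ⟨v, fun x => (congrFun hv x).symm⟩
  by_contra hmem
  -- A functional vanishing on the range of `bellman` but not at `w` has coefficients `d` satisfying
  -- the homogeneous flow equation. As `lamStar` is positive, it can move along both `d` and `-d`,
  -- so the derivative `f w` must vanish.
  obtain ⟨f, hfw, hf⟩ := Submodule.exists_le_ker_of_notMem hmem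
  set d : S × A → ℝ := fun x => f (Pi.single x 1) with hd
  have hfd : ∀ u : S × A → ℝ, f u = ∑ x, u x * d x := by
    intro u
    conv_lhs => rw [← Finset.univ_sum_single u]
    rw [map_sum]
    refine Finset.sum_congr rfl fun x _ => ?_
    have : (Pi.single x (u x) : S × A → ℝ) = u x • Pi.single x 1 := by
      rw [← Pi.single_smul]; simp
    rw [this, map_smul, smul_eq_mul]
  have hflow : ∀ j, ∑ a, (d (j, a) - M.γ * ∑ i, M.P a i j * d (i, a)) = 0 := by
    intro j
    have h0 : f (B (Pi.single j 1)) = 0 := hf ⟨_, rfl⟩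
    rw [hfd] at h0
    have h1 := sum_mul_bellman M d (Pi.single j 1)
    rw [Finset.sum_congr rfl fun x _ => mul_comm _ _] at h1
    have h2 : ∑ x, M.bellman (Pi.single j 1) x * d x = 0 := h0
    rw [h2] at h1
    simpa [Pi.single_apply] using h1.symm
  have hfeas : ∀ᶠ t : ℝ in nhds 0, (fun x => lamStar x + t * d x) ∈ feasible M := by
    have h1 : ∀ᶠ t : ℝ in nhds 0, ∀ x, 0 < lamStar x + t * d x := by
      rw [Filter.eventually_all]
      intro x
      have hcont : ContinuousAt (fun t : ℝ => lamStar x + t * d x) 0 := by fun_prop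
      exact hcont.eventually (lt_mem_nhds (by simpa using hpos x))
    filter_upwards [h1] with t ht
    refine feasible_of_flow (fun x => (ht x).le) fun j => ?_
    have : ∑ a, (lamStar (j, a) + t * d (j, a)
          - M.γ * ∑ i, M.P a i j * (lamStar (i, a) + t * d (i, a)))
          = ∑ a, (lamStar (j, a) - M.γ * ∑ i, M.P a i j * lamStar (i, a))
          + t * ∑ a, (d (j, a) - M.γ * ∑ i, M.P a i j * d (i, a)) := by
      rw [Finset.mul_sum, ← Finset.sum_add_distrib]
      refine Finset.sum_congr rfl fun a _ => ?_
      have : ∑ i, M.P a i j * (lamStar (i, a) + t * d (i, a))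
          = ∑ i, M.P a i j * lamStar (i, a) + t * ∑ i, M.P a i j * d (i, a) := by
        rw [Finset.mul_sum, ← Finset.sum_add_distrib]
        exact Finset.sum_congr rfl fun i _ => by ring
      rw [this]; ring
    rw [this, hflow, h.1.2 j]; ring
  have hline : HasDerivAt (fun (t : ℝ) (x : S × A) => lamStar x + t * d x) d 0 := by
    rw [hasDerivAt_pi]
    intro x
    simpa using ((hasDerivAt_id (0 : ℝ)).mul_const (d x)).const_add (lamStar x)
  have hρ : HasDerivAt (fun t : ℝ => caution M μ fun x => lamStar x + t * d x)
      (∑ x, cautionGrad M μ lamStar x * d x) 0 := by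
    have h1 := hasFDerivAt_caution M μ (fun x => lamStar x + 0 * d x) hμ (by simpa using hpos)
    have h2 := h1.comp_hasDerivAt (0 : ℝ) hline
    simp only [zero_mul, add_zero] at h2
    refine h2.congr_deriv ?_
    simp
  have hr : HasDerivAt (fun t : ℝ => ∑ x, (lamStar x + t * d x) * M.expRew x)
      (∑ x, d x * M.expRew x) 0 := by
    refine HasDerivAt.fun_sum fun x _ => ?_
    exact (hasDerivAt_pi.1 hline x).mul_const _
  have hmax : IsLocalMax (fun t : ℝ => ∑ x, (lamStar x + t * d x) * M.expRew x
      - c * caution M μ fun x => lamStar x + t * d x) 0 := by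
    filter_upwards [hfeas] with t ht
    simpa using h.2 ht
  have hzero := hmax.hasDerivAt_eq_zero (hr.sub (hρ.const_mul c))
  apply hfw
  rw [hfd, ← hzero, Finset.mul_sum, ← Finset.sum_sub_distrib]
  exact Finset.sum_congr rfl fun x _ => by simp only [hw]; ring

theorem expRew_nonneg {S A : Type*} [Fintype S] (M : MDP S A) (x : S × A) : 0 ≤ M.expRew x :=
  Finset.sum_nonneg fun _ _ => mul_nonneg (M.P_nonneg _ _ _) (M.rew_nonneg _ _ _)

theorem expRew_le_one {S A : Type*} [Fintype S] (M : MDP S A) (x : S × A) : M.expRew x ≤ 1 := by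
  rw [← M.P_sum x.2 x.1]
  exact Finset.sum_le_sum fun j _ =>
    mul_le_of_le_one_right (M.P_nonneg _ _ _) (M.rew_le_one _ _ _)

theorem abs_average_le {S A : Type*} [Fintype S] (M : MDP S A) {v : S → ℝ} {R : ℝ} (hv : ∀ s, |v s| ≤ R) (x : S × A) :
    |∑ j, M.P x.2 x.1 j * v j| ≤ R := by
  calc |∑ j, M.P x.2 x.1 j * v j| ≤ ∑ j, M.P x.2 x.1 j * R := by
        refine (Finset.abs_sum_le_sum_abs _ _).trans (Finset.sum_le_sum fun j _ => ?_)
        rw [abs_mul, abs_of_nonneg (M.P_nonneg _ _ _)]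
        exact mul_le_mul_of_nonneg_left (hv j) (M.P_nonneg _ _ _)
    _ = R := by rw [← Finset.sum_mul, M.P_sum, one_mul]

theorem marginal_ge {M : MDP S A} {lam : S × A → ℝ} (h : lam ∈ feasible M) (s : S) :
    1 / (Fintype.card S : ℝ) ≤ ∑ a, lam (s, a) := by
  have h1 := h.2 s
  rw [Finset.sum_sub_distrib] at h1
  have h2 : 0 ≤ ∑ a, M.γ * ∑ i, M.P a i s * lam (i, a) :=
    Finset.sum_nonneg fun a _ => mul_nonneg M.γ_pos.le
      (Finset.sum_nonneg fun i _ => mul_nonneg (M.P_nonneg _ _ _) (h.1.1 _))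
  unfold xi at h1
  linarith

theorem marginal_le {M : MDP S A} {lam : S × A → ℝ} (h : lam ∈ feasible M) (s : S) :
    (1 - M.γ) * ∑ a, lam (s, a) ≤ 1 - (1 - M.γ) + (1 - M.γ) / Fintype.card S := by
  have hG := M.one_sub_pos
  have hS : (0 : ℝ) < Fintype.card S := by exact_mod_cast Fintype.card_pos_iff.2 ⟨s⟩
  have h1 := h.2 s
  rw [Finset.sum_sub_distrib] at h1
  have h2 : ∑ a, M.γ * ∑ i, M.P a i s * lam (i, a) ≤ M.γ * (1 - M.γ)⁻¹ := by
    rw [← Finset.mul_sum, ← sum_eq_of_mem_dualRegion h.1, Fintype.sum_prod_type, Finset.sum_comm]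
    refine mul_le_mul_of_nonneg_left ?_ M.γ_pos.le
    refine Finset.sum_le_sum fun i _ => Finset.sum_le_sum fun a _ => ?_
    refine mul_le_of_le_one_left (h.1.1 _) ?_
    rw [← M.P_sum a i]
    exact Finset.single_le_sum (fun j _ => M.P_nonneg a i j) (Finset.mem_univ s)
  unfold xi at h1
  have h3 : ∑ a, lam (s, a) ≤ M.γ * (1 - M.γ)⁻¹ + 1 / Fintype.card S := by linarith
  calc (1 - M.γ) * ∑ a, lam (s, a)
      ≤ (1 - M.γ) * (M.γ * (1 - M.γ)⁻¹ + 1 / Fintype.card S) := by gcongr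
    _ = _ := by field_simp; ring

/-- The multipliers are bounded by `(1 + c σ) / (1 - γ)`. -/
theorem abs_multiplier_le {M : MDP S A} {c σ δ₀ : ℝ} {μ lamStar : S × A → ℝ}
    (hn : 2 ≤ Fintype.card S * Fintype.card A) (hc : 0 < c) (hδ₀ : 0 < δ₀)
    (hμ : ∀ x, δ₀ ≤ μ x) (hμ1 : ∑ x, μ x = 1)
    (hσ : ∀ lam ∈ dualRegion M, (∀ x, δ₀ ≤ lam x) → ∀ x, |cautionGrad M μ lam x| ≤ σ)
    (hfeas : lamStar ∈ feasible M) (hpos : ∀ x, 0 < lamStar x) {v : S → ℝ}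
    (hv : ∀ x, M.expRew x - c * cautionGrad M μ lamStar x = M.bellman v x) (s : S) :
    |v s| ≤ (1 + c * σ) / (1 - M.γ) := by
  have hG := M.one_sub_pos
  have hne : Nonempty S := ⟨s⟩
  have hA : Nonempty A := by
    rw [← Fintype.card_pos_iff]; exact Nat.pos_of_mul_pos_left (by omega : 0 < Fintype.card S * Fintype.card A)
  -- At a state of maximal `|v|` the discounted average of `v` is at most `γ R`, so the stationarity
  -- equations bound `(1 - γ) R`.
  obtain ⟨s₀, -, hs₀⟩ := Finset.exists_max_image Finset.univ (fun s => |v s|) Finset.univ_nonempty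
  set R := |v s₀| with hR
  have hvR : ∀ s, |v s| ≤ R := fun s => hs₀ s (Finset.mem_univ s)
  suffices hmain : R ≤ 1 + c * σ + M.γ * R by
    refine (hvR s).trans ?_
    rw [le_div_iff₀ hG]
    linarith
  set W := ∑ a, μ (s₀, a) with hW
  set m := (1 - M.γ) * ∑ a, lamStar (s₀, a) with hm
  have hμ0 : ∀ x, 0 < μ x := fun x => hδ₀.trans_le (hμ x)
  have hW0 : 0 < W := Finset.sum_pos (fun a _ => hμ0 _) Finset.univ_nonempty
  have hm0 : 0 < m := mul_pos hG (Finset.sum_pos (fun a _ => hpos _) Finset.univ_nonempty)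
  have hbd := abs_marginal_le hn hδ₀ hμ hμ1 hσ s₀ (m := m) (by
    have := mul_le_mul_of_nonneg_left (marginal_ge hfeas s₀) hG.le
    rwa [mul_one_div] at this) (marginal_le hfeas s₀)
  rw [abs_le] at hbd
  -- Some action `a` has `lamStar / μ` at least the ratio of the marginals, and some `b` at most.
  -- Stationarity at `a` bounds `v s₀` above, at `b` below, and only the marginal ratio has to obey
  -- `σ`.
  have heq : ∑ a, μ (s₀, a) * m = ∑ a, (1 - M.γ) * lamStar (s₀, a) * W := by
    rw [← Finset.sum_mul, ← Finset.sum_mul, ← Finset.mul_sum, ← hm, mul_comm]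
  obtain ⟨a, -, ha⟩ := Finset.exists_le_of_sum_le Finset.univ_nonempty heq.le
  obtain ⟨b, -, hb⟩ := Finset.exists_le_of_sum_le Finset.univ_nonempty heq.ge
  have hga : (1 - M.γ) * (1 + Real.log (m / W)) ≤ cautionGrad M μ lamStar (s₀, a) := by
    have : m / W ≤ (1 - M.γ) * lamStar (s₀, a) / μ (s₀, a) := by
      rw [div_le_div_iff₀ hW0 (hμ0 _)]; linarith
    unfold cautionGrad
    gcongr
  have hgb : cautionGrad M μ lamStar (s₀, b) ≤ (1 - M.γ) * (1 + Real.log (m / W)) := by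
    have h1 : (1 - M.γ) * lamStar (s₀, b) / μ (s₀, b) ≤ m / W := by
      rw [div_le_div_iff₀ (hμ0 _) hW0]; linarith
    have h2 : 0 < (1 - M.γ) * lamStar (s₀, b) / μ (s₀, b) :=
      div_pos (mul_pos hG (hpos _)) (hμ0 _)
    unfold cautionGrad
    gcongr
  have ea := hv (s₀, a)
  have eb := hv (s₀, b)
  simp only [MDP.bellman] at ea eb
  have pa := abs_le.1 (abs_average_le M hvR (s₀, a))
  have pb := abs_le.1 (abs_average_le M hvR (s₀, b))
  simp only at pa pb
  have hγ := M.γ_pos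
  have qa := mul_le_mul_of_nonneg_left pa.2 hγ.le
  have qb := mul_le_mul_of_nonneg_left pb.1 hγ.le
  have ga := mul_le_mul_of_nonneg_left (hbd.1.trans hga) hc.le
  have gb := mul_le_mul_of_nonneg_left (hgb.trans hbd.2) hc.le
  refine abs_le.2 ⟨?_, ?_⟩
  · linarith [expRew_nonneg M (s₀, b)]
  · linarith [expRew_le_one M (s₀, a)]

/-- The Lagrangian gap at the optimal multiplier is exactly a divergence. -/
theorem mul_kl_eq_gap {M : MDP S A} {c : ℝ} {μ lamStar : S × A → ℝ} (hμ : ∀ x, 0 < μ x)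
    (hfeas : lamStar ∈ feasible M) (hpos : ∀ x, 0 < lamStar x) {v : S → ℝ}
    (hv : ∀ x, M.expRew x - c * cautionGrad M μ lamStar x = M.bellman v x)
    {lam : S × A → ℝ} (hlam : ∀ x, 0 < lam x) (hsum : ∑ x, lam x = (1 - M.γ)⁻¹) :
    c * kl (fun x => (1 - M.γ) * lam x) (fun x => (1 - M.γ) * lamStar x) =
      (∑ x, lamStar x * M.expRew x - c * caution M μ lamStar)
        - (∑ x, lam x * M.expRew x - c * caution M μ lam)
        - (∑ j, v j * xi S j - ∑ x, lam x * M.bellman v x) := by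
  have hG := M.one_sub_pos
  rw [← sum_bellman_of_feasible hfeas v]
  have hr : ∀ x, M.expRew x = M.bellman v x + c * cautionGrad M μ lamStar x := fun x => by
    rw [← hv x]; ring
  have h1 : ∀ l : S × A → ℝ, ∑ x, l x * M.expRew x
      = ∑ x, l x * M.bellman v x + c * ∑ x, l x * cautionGrad M μ lamStar x := by
    intro l
    rw [Finset.mul_sum, ← Finset.sum_add_distrib]
    exact Finset.sum_congr rfl fun x _ => by rw [hr x]; ring
  -- Three-point identity of the entropy: pairing `l` with the gradient at `lamStar` gives the
  -- caution of `l` minus its divergence from `lamStar`, up to the constant mass 1.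
  have h2 : ∀ l : S × A → ℝ, (∀ x, 0 < l x) → ∑ x, l x = (1 - M.γ)⁻¹ →
      ∑ x, l x * cautionGrad M μ lamStar x = 1 + caution M μ l
        - kl (fun x => (1 - M.γ) * l x) (fun x => (1 - M.γ) * lamStar x) := by
    intro l hl hs
    have : (1 : ℝ) = ∑ x, (1 - M.γ) * l x := by
      rw [← Finset.mul_sum, hs, mul_inv_cancel₀ hG.ne']
    rw [show ∀ a b : ℝ, 1 + a - b = (∑ x, (1 - M.γ) * l x) + a - b from fun a b => by rw [← this]]
    unfold caution kl
    rw [← Finset.sum_add_distrib, ← Finset.sum_sub_distrib]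
    refine Finset.sum_congr rfl fun x _ => ?_
    simp only [cautionGrad]
    have a1 := (mul_pos hG (hl x)).ne'
    have a2 := (mul_pos hG (hpos x)).ne'
    rw [Real.log_div a1 (hμ x).ne', Real.log_div a1 a2, Real.log_div a2 (hμ x).ne']
    ring
  have h3 : kl (fun x => (1 - M.γ) * lamStar x) (fun x => (1 - M.γ) * lamStar x) = 0 := by
    unfold kl
    refine Finset.sum_eq_zero fun x _ => ?_
    rw [div_self (mul_pos hG (hpos x)).ne', Real.log_one, mul_zero]
  rw [h1 lamStar, h1 lam, h2 lam hlam hsum,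
    h2 lamStar hpos (sum_eq_of_mem_dualRegion hfeas.1), h3]
  ring

end

/-! ### The two update rules: projection and entropic mirror step. -/

section

variable {S A : Type*} [Fintype S] [Fintype A]

/-- The projection is defined by choice; compactness of the box supplies a minimizer. -/
theorem project_spec {S A : Type*} [Fintype S] {M : MDP S A} {c σ : ℝ} (hne : (valueRegion M c σ).Nonempty) (w : S → ℝ) :
    project (valueRegion M c σ) w ∈ valueRegion M c σ ∧
      IsMinOn (fun u : S → ℝ => ∑ s, (u s - w s) ^ 2) (valueRegion M c σ)
        (project (valueRegion M c σ) w) := by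
  refine Classical.epsilon_spec (p := fun x => x ∈ valueRegion M c σ ∧
    IsMinOn (fun u : S → ℝ => ∑ s, (u s - w s) ^ 2) (valueRegion M c σ) x) ?_
  have hcomp : IsCompact (valueRegion M c σ) := by
    have : valueRegion M c σ = Set.pi Set.univ fun _ : S =>
        Set.Icc (-(2 * ((1 + c * σ) / (1 - M.γ)))) (2 * ((1 + c * σ) / (1 - M.γ))) := by
      ext v
      simp only [valueRegion, abs_le, Set.mem_pi, Set.mem_univ, true_implies, Set.mem_Icc]
      rfl
    rw [this]
    exact isCompact_univ_pi fun _ => isCompact_Icc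
  obtain ⟨x, hx, hmin⟩ := hcomp.exists_isMinOn hne
    (f := fun u : S → ℝ => ∑ s, (u s - w s) ^ 2) (by fun_prop)
  exact ⟨x, hx, hmin⟩

theorem sum_sq_project_sub_le {S A : Type*} [Fintype S] {M : MDP S A} {c σ : ℝ} (w : S → ℝ) {u : S → ℝ}
    (hu : u ∈ valueRegion M c σ) :
    ∑ s, (project (valueRegion M c σ) w s - u s) ^ 2 ≤ ∑ s, (w s - u s) ^ 2 := by
  obtain ⟨hx, hmin⟩ := project_spec ⟨u, hu⟩ w
  set x := project (valueRegion M c σ) w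
  have hexp : ∀ θ : ℝ, ∑ s, ((1 - θ) * x s + θ * u s - w s) ^ 2
      = ∑ s, (x s - w s) ^ 2 + 2 * θ * ∑ s, (u s - x s) * (x s - w s)
        + θ ^ 2 * ∑ s, (u s - x s) ^ 2 := by
    intro θ
    rw [Finset.mul_sum, Finset.mul_sum, ← Finset.sum_add_distrib, ← Finset.sum_add_distrib]
    exact Finset.sum_congr rfl fun s _ => by ring
  have hvar : 0 ≤ ∑ s, (u s - x s) * (x s - w s) := by
    by_contra! hneg
    set I := ∑ s, (u s - x s) * (x s - w s) with hI
    set Q := ∑ s, (u s - x s) ^ 2 with hQ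
    have hQ0 : 0 ≤ Q := Finset.sum_nonneg fun s _ => sq_nonneg _
    have hcomb : ∀ θ : ℝ, 0 ≤ θ → θ ≤ 1 → 0 ≤ 2 * θ * I + θ ^ 2 * Q := by
      intro θ h0 h1
      have hmem : (fun s => (1 - θ) * x s + θ * u s) ∈ valueRegion M c σ := by
        intro s
        have a1 := abs_le.1 (hx s)
        have a2 := abs_le.1 (hu s)
        exact abs_le.2 ⟨by nlinarith, by nlinarith⟩
      have := hmin hmem
      simp only [Set.mem_ofPred_eq, hexp] at this
      linarith
    -- Contradiction point on the segment from `x` to `u`: `θ Q ≤ -I` makes `2 I + θ Q` negative,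
    -- and the denominator stays positive even if `Q = 0`.
    have hθ : 0 < -I / (Q - I) := div_pos (by linarith) (by linarith)
    have h1 := hcomb (-I / (Q - I)) hθ.le (by rw [div_le_one (by linarith)]; linarith)
    have h2 : 0 ≤ 2 * I + -I / (Q - I) * Q := by
      by_contra! h3
      nlinarith
    have h3 : -I / (Q - I) * Q ≤ -I := by
      rw [div_mul_eq_mul_div, div_le_iff₀ (by linarith)]
      nlinarith
    linarith
  have h1 := hexp 1
  have h2 : ∑ s, (w s - u s) ^ 2 = ∑ s, (x s - w s) ^ 2
      + 2 * ∑ s, (u s - x s) * (x s - w s) + ∑ s, (x s - u s) ^ 2 := by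
    rw [Finset.mul_sum, ← Finset.sum_add_distrib, ← Finset.sum_add_distrib]
    exact Finset.sum_congr rfl fun s _ => by ring
  have h3 : 0 ≤ ∑ s, (x s - w s) ^ 2 := Finset.sum_nonneg fun s _ => sq_nonneg _
  linarith

/-- Up to a constant the objective is `1/β` times the sum of `l - l log (l / w)`, and each summand
is at most `w x`, with equality only at `l x = w x`. The `-1` in the exponent is the derivative of
the unnormalized `l log l`; rescaling removes it. -/
theorem halfStep_eq {M : MDP S A} {β : ℝ} (hβ : 0 < β) (g : S × A → ℝ) {lam : S × A → ℝ}
    (hlam : ∀ x, 0 < lam x) :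
    halfStep M β g lam = fun x => lam x * Real.exp (β * g x - 1) := by
  have hG := M.one_sub_pos
  set w : S × A → ℝ := fun x => lam x * Real.exp (β * g x - 1) with hw
  have hw0 : ∀ x, 0 < w x := fun x => mul_pos (hlam x) (Real.exp_pos _)
  set Obj : (S × A → ℝ) → ℝ := fun l => ∑ x, g x * (l x - lam x)
      - 1 / ((1 - M.γ) * β) * kl (fun x => (1 - M.γ) * l x) (fun x => (1 - M.γ) * lam x) with hObj
  have hval : ∀ l : S × A → ℝ, (∀ x, 0 ≤ l x) →
      Obj l = -∑ x, g x * lam x + 1 / β * ∑ x, (l x - l x * Real.log (l x / w x)) := by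
    intro l hl
    simp only [hObj, kl]
    rw [Finset.mul_sum, Finset.mul_sum, ← Finset.sum_neg_distrib, ← Finset.sum_sub_distrib,
      ← Finset.sum_add_distrib]
    refine Finset.sum_congr rfl fun x _ => ?_
    rcases (hl x).eq_or_lt with h0 | h0
    · simp [← h0]
    · rw [mul_div_mul_left _ _ hG.ne', hw, Real.log_div h0.ne' (hlam x).ne']
      simp only
      rw [Real.log_div h0.ne' (mul_pos (hlam x) (Real.exp_pos _)).ne',
        Real.log_mul (hlam x).ne' (Real.exp_pos _).ne', Real.log_exp]
      field_simp
      ring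
  have hterm : ∀ l : S × A → ℝ, (∀ x, 0 ≤ l x) → ∀ x,
      l x - l x * Real.log (l x / w x) ≤ w x := by
    intro l hl x
    linarith [sub_le_mul_log_div (hl x) (hw0 x)]
  have hwval : Obj w = -∑ x, g x * lam x + 1 / β * ∑ x, w x := by
    rw [hval w fun x => (hw0 x).le]
    congr 2
    refine Finset.sum_congr rfl fun x _ => ?_
    rw [div_self (hw0 x).ne', Real.log_one]
    ring
  have hspec := Classical.epsilon_spec (p := fun u => u ∈ {l : S × A → ℝ | ∀ x, 0 ≤ l x} ∧
    IsMaxOn Obj {l : S × A → ℝ | ∀ x, 0 ≤ l x} u) ⟨w, fun x => (hw0 x).le, fun l hl => by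
      simp only [Set.mem_ofPred_eq]
      rw [hval l hl, hwval]
      have := Finset.sum_le_sum fun x (_ : x ∈ Finset.univ) => hterm l hl x
      gcongr⟩
  change halfStep M β g lam ∈ _ ∧ IsMaxOn Obj _ (halfStep M β g lam) at hspec
  set u := halfStep M β g lam
  obtain ⟨hu, hmax⟩ := hspec
  have h1 : Obj w ≤ Obj u := hmax (fun x => (hw0 x).le : w ∈ {l : S × A → ℝ | ∀ x, 0 ≤ l x})
  rw [hval u hu, hwval] at h1
  have h2 : ∑ x, w x ≤ ∑ x, (u x - u x * Real.log (u x / w x)) :=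
    le_of_mul_le_mul_left (by linarith) (one_div_pos.2 hβ)
  have h3 := (Finset.sum_eq_sum_iff_of_le fun x (_ : x ∈ Finset.univ) => hterm u hu x).1
    (le_antisymm (Finset.sum_le_sum fun x _ => hterm u hu x) h2)
  ext x
  exact eq_of_mul_log_div_le (hu x) (hw0 x) (by linarith [h3 x (Finset.mem_univ x)])

/-- One step of entropic mirror ascent on the simplex along `gain - η ∇KL(· ‖ μ)`. -/
theorem kl_mirror_step_le {ι : Type*} [Fintype ι] [Nonempty ι] {u p p' μ gain : ι → ℝ}
    {β η k : ℝ}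
    (hu : ∀ i, 0 < u i) (hu1 : ∑ i, u i = 1) (hp : ∀ i, 0 < p i) (hp1 : ∑ i, p i = 1)
    (hμ : ∀ i, 0 < μ i) (hgain : ∀ i, gain i ≤ 0) (hβ : 0 ≤ β) (hη : 0 ≤ η)
    (hp' : ∀ i, p' i = p i * Real.exp (β * gain i - η * Real.log (p i / μ i) + k) /
      ∑ j, p j * Real.exp (β * gain j - η * Real.log (p j / μ j) + k)) :
    kl u p' ≤ kl u p - β * ∑ i, (u i - p i) * gain i + η * (kl u μ - kl p μ)
      + β ^ 2 * ∑ i, p i * gain i ^ 2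
      + η ^ 2 * ∑ i, p i * Real.log (p i / μ i) ^ 2 *
          max 1 (Real.exp (-η * Real.log (p i / μ i))) := by
  set l : ι → ℝ := fun i => Real.log (p i / μ i) with hl
  set Z := ∑ j, p j * Real.exp (β * gain j - η * l j) with hZ
  have hZ0 : 0 < Z := Finset.sum_pos (fun i _ => mul_pos (hp i) (Real.exp_pos _))
    Finset.univ_nonempty
  have hp2 : ∀ i, p' i = p i * Real.exp (β * gain i - η * l i) / Z := by
    intro i
    rw [hp' i]
    simp only [Real.exp_add, ← mul_assoc]
    rw [← Finset.sum_mul, mul_div_mul_right _ _ (Real.exp_pos k).ne']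
  have hkl : kl u p' = kl u p - ∑ i, u i * (β * gain i - η * l i) + Real.log Z := by
    have : Real.log Z = ∑ i, u i * Real.log Z := by rw [← Finset.sum_mul, hu1, one_mul]
    rw [this]
    unfold kl
    rw [← Finset.sum_sub_distrib, ← Finset.sum_add_distrib]
    refine Finset.sum_congr rfl fun i _ => ?_
    have e := Real.exp_pos (β * gain i - η * l i)
    rw [hp2 i, Real.log_div (hu i).ne' (div_pos (mul_pos (hp i) e) hZ0).ne',
      Real.log_div (mul_pos (hp i) e).ne' hZ0.ne', Real.log_mul (hp i).ne' e.ne', Real.log_exp,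
      Real.log_div (hu i).ne' (hp i).ne']
    ring
  have hZle : Z ≤ 1 + ∑ i, p i * (β * gain i - η * l i) + β ^ 2 * ∑ i, p i * gain i ^ 2
      + η ^ 2 * ∑ i, p i * l i ^ 2 * max 1 (Real.exp (-η * l i)) := by
    rw [show ∀ a b c : ℝ, 1 + a + b + c = ∑ i, p i + a + b + c from fun a b c => by rw [hp1],
      Finset.mul_sum, Finset.mul_sum, ← Finset.sum_add_distrib, ← Finset.sum_add_distrib,
      ← Finset.sum_add_distrib]
    refine Finset.sum_le_sum fun i _ => ?_
    have h := exp_add_le_quadratic (a := β * gain i) (b := -η * l i)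
      (mul_nonpos_of_nonneg_of_nonpos hβ (hgain i))
    have h2 := mul_le_mul_of_nonneg_left h (hp i).le
    rw [show β * gain i - η * l i = β * gain i + -η * l i by ring]
    refine h2.trans_eq ?_
    ring
  have hlog := Real.log_le_sub_one_of_pos hZ0
  -- The surplus `-η kl u p` that arises here has the favourable sign and is dropped through `hnn`.
  have hul : ∑ i, u i * l i = kl u μ - kl u p := by
    unfold kl
    rw [← Finset.sum_sub_distrib]
    refine Finset.sum_congr rfl fun i _ => ?_
    simp only [hl]
    rw [Real.log_div (hu i).ne' (hp i).ne', Real.log_div (hu i).ne' (hμ i).ne',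
      Real.log_div (hp i).ne' (hμ i).ne']
    ring
  have hsplit : ∀ f : ι → ℝ, ∑ i, f i * (β * gain i - η * l i)
      = β * ∑ i, f i * gain i - η * ∑ i, f i * l i := by
    intro f
    rw [Finset.mul_sum, Finset.mul_sum, ← Finset.sum_sub_distrib]
    exact Finset.sum_congr rfl fun i _ => by ring
  have hdiff : ∑ i, (u i - p i) * gain i = ∑ i, u i * gain i - ∑ i, p i * gain i := by
    rw [← Finset.sum_sub_distrib]
    exact Finset.sum_congr rfl fun i _ => by ring
  have hpl : ∑ i, p i * l i = kl p μ := rfl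
  have hnn := mul_nonneg hη (kl_nonneg (fun i => (hu i).le) hp (hu1.trans hp1.symm))
  rw [hkl, hsplit u, hul, hdiff]
  rw [hsplit p, hpl] at hZle
  linarith

/-! ### The sampling law, and the mean and size of the gradient estimates. -/

theorem sum_sample (F : Sample S A → ℝ) :
    ∑ z, F z = ∑ x : S × A, ∑ j, ∑ k, F ⟨x.1, x.2, j, k⟩ := by
  rw [← Equiv.sum_comp (Sample.equiv S A)]
  simp only [Fintype.sum_prod_type]
  rfl

theorem zeta_ge {M : MDP S A} {δ : ℝ} (hδ : 0 ≤ δ) (hδ' : δ ≤ 1 / 2) {lam : S × A → ℝ}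
    {x : S × A} (hlam : 0 ≤ lam x) : (1 - M.γ) * lam x / 2 ≤ zeta M δ lam x := by
  unfold zeta
  have h1 : 0 ≤ δ / ((Fintype.card S : ℝ) * Fintype.card A) := by positivity
  have := mul_nonneg M.one_sub_pos.le hlam
  nlinarith

theorem zeta_pos {M : MDP S A} {δ : ℝ} (hδ : 0 ≤ δ) (hδ' : δ ≤ 1 / 2) {lam : S × A → ℝ}
    {x : S × A} (hlam : 0 < lam x) : 0 < zeta M δ lam x :=
  lt_of_lt_of_le (by have := mul_pos M.one_sub_pos hlam; positivity) (zeta_ge hδ hδ' hlam.le)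

theorem sum_zeta [Nonempty S] [Nonempty A] {M : MDP S A} {δ : ℝ} {lam : S × A → ℝ}
    (h : ∑ x, lam x = (1 - M.γ)⁻¹) : ∑ x, zeta M δ lam x = 1 := by
  have hG := M.one_sub_pos
  have hA : (Fintype.card A : ℝ) ≠ 0 := by exact_mod_cast Fintype.card_ne_zero
  have hS : (Fintype.card S : ℝ) ≠ 0 := by exact_mod_cast Fintype.card_ne_zero
  unfold zeta
  rw [Finset.sum_add_distrib, ← Finset.mul_sum, h, Finset.sum_const, Finset.card_univ,
    Fintype.card_prod, nsmul_eq_mul]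
  push_cast
  field_simp
  ring

theorem sampleProb_nonneg {M : MDP S A} {δ : ℝ} (hδ : 0 ≤ δ) (hδ' : δ ≤ 1 / 2)
    {lam : S × A → ℝ} (hlam : ∀ x, 0 < lam x) (z : Sample S A) : 0 ≤ sampleProb M δ lam z :=
  mul_nonneg (mul_nonneg (zeta_pos hδ hδ' (hlam _)).le (M.P_nonneg _ _ _))
    (by unfold xi; positivity)

/-- Expectation of a quantity that does not depend on `sbar`. -/
theorem sum_sampleProb_mul [Nonempty S] (M : MDP S A) (δ : ℝ) (lam : S × A → ℝ)
    (F : S × A → S → ℝ) :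
    ∑ z, sampleProb M δ lam z * F (z.s, z.a) z.s' =
      ∑ x, zeta M δ lam x * ∑ j, M.P x.2 x.1 j * F x j := by
  rw [sum_sample]
  refine Finset.sum_congr rfl fun x _ => ?_
  rw [Finset.mul_sum]
  refine Finset.sum_congr rfl fun j _ => ?_
  simp only [sampleProb]
  rw [← Finset.sum_mul, ← Finset.mul_sum, sum_xi]
  ring

theorem sum_sampleProb [Nonempty S] [Nonempty A] {M : MDP S A} {δ : ℝ} {lam : S × A → ℝ}
    (h : ∑ x, lam x = (1 - M.γ)⁻¹) : ∑ z, sampleProb M δ lam z = 1 := by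
  have := sum_sampleProb_mul M δ lam fun _ _ => 1
  simpa [M.P_sum, sum_zeta h] using this

theorem sum_sampleProb_mul_sbar [Nonempty S] [Nonempty A] {M : MDP S A} {δ : ℝ}
    {lam : S × A → ℝ} (h : ∑ x, lam x = (1 - M.γ)⁻¹) (w : S → ℝ) :
    ∑ z, sampleProb M δ lam z * w z.sbar = ∑ s, w s * xi S s := by
  rw [sum_sample]
  have : ∀ x : S × A, ∑ j, ∑ k, sampleProb M δ lam ⟨x.1, x.2, j, k⟩ * w k
      = zeta M δ lam x * ∑ s, w s * xi S s := by
    intro x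
    calc ∑ j, ∑ k, sampleProb M δ lam ⟨x.1, x.2, j, k⟩ * w k
        = ∑ j, M.P x.2 x.1 j * (zeta M δ lam x * ∑ s, w s * xi S s) := by
          refine Finset.sum_congr rfl fun j _ => ?_
          rw [Finset.mul_sum, Finset.mul_sum]
          refine Finset.sum_congr rfl fun k _ => ?_
          simp only [sampleProb]
          ring
      _ = _ := by rw [← Finset.sum_mul, M.P_sum, one_mul]
  simp only [this]
  rw [← Finset.sum_mul, sum_zeta h, one_mul]

/-- The iterates stay in this set. -/
structure IsState (M : MDP S A) (p : Params) (q : (S → ℝ) × (S × A → ℝ)) : Prop where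
  mem : q.1 ∈ valueRegion M p.c p.σ
  pos : ∀ x, 0 < q.2 x
  sum : ∑ x, q.2 x = (1 - M.γ)⁻¹

/-- The noisy payoff of the sampled pair `(s, a)`. -/
def payoff (M : MDP S A) (p : Params) (v : S → ℝ) (x : S × A) (j : S) : ℝ :=
  M.rew x.1 j x.2 + M.γ * v j - v x.1 - p.M₁

/-- With `R = (1 + c σ) / (1 - γ)` and `|v| ≤ 2R`, the shift `M₁ = 4R` makes the payoff at most `1 -
2 (1 + c σ)`, hence nonpositive, and keeps it above `-8R`. -/
theorem payoff_bounds {S A : Type*} [Fintype S] {M : MDP S A} {p : Params} (hB : 1 ≤ 1 + p.c * p.σ)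
    (hM : p.M₁ = 4 * (1 + p.c * p.σ) / (1 - M.γ)) {v : S → ℝ}
    (hv : v ∈ valueRegion M p.c p.σ) (x : S × A) (j : S) :
    payoff M p v x j ≤ 0 ∧ payoff M p v x j ^ 2 ≤ 64 * ((1 + p.c * p.σ) / (1 - M.γ)) ^ 2 := by
  have hG := M.one_sub_pos
  have h1 := abs_le.1 (hv j)
  have h2 := abs_le.1 (hv x.1)
  rw [mul_div_assoc] at hM
  set R := (1 + p.c * p.σ) / (1 - M.γ) with hR
  have hBR : 1 + p.c * p.σ = (1 - M.γ) * R := by rw [hR]; field_simp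
  have hr0 := M.rew_nonneg x.1 j x.2
  have hr1 := M.rew_le_one x.1 j x.2
  have hγ := M.γ_pos
  have hup : payoff M p v x j ≤ 0 := by
    unfold payoff
    nlinarith
  refine ⟨hup, ?_⟩
  have hR0 : 0 ≤ R := by rw [hR]; positivity
  have hlow : -(8 * R) ≤ payoff M p v x j := by
    unfold payoff
    nlinarith [M.γ_lt_one]
  nlinarith

variable [DecidableEq S]

/-- Drawing the pair from `ζ` cancels the weight `1 / ζ`: the estimate is unbiased for the
`v`-gradient of the Lagrangian. -/
theorem expect_gradV [Nonempty S] [Nonempty A] {M : MDP S A} {δ : ℝ} {lam : S × A → ℝ}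
    (hδ : 0 ≤ δ) (hδ' : δ ≤ 1 / 2) (hlam : ∀ x, 0 < lam x) (h : ∑ x, lam x = (1 - M.γ)⁻¹)
    (w : S → ℝ) :
    ∑ z, sampleProb M δ lam z * ∑ i, gradV M δ lam z i * w i =
      ∑ s, w s * xi S s - ∑ x, lam x * M.bellman w x := by
  have hz : ∀ x, 0 < zeta M δ lam x := fun x => zeta_pos hδ hδ' (hlam x)
  have h1 : ∀ z : Sample S A, ∑ i, gradV M δ lam z i * w i = w z.sbar +
      lam (z.s, z.a) / zeta M δ lam (z.s, z.a) * (M.γ * w z.s' - w z.s) := by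
    intro z
    simp only [gradV, if_pos (hz _), add_mul, Finset.sum_add_distrib, mul_assoc, sub_mul,
      ← Finset.mul_sum, Finset.sum_sub_distrib]
    simp [Pi.single_apply]
  simp only [h1, mul_add, Finset.sum_add_distrib]
  rw [sum_sampleProb_mul_sbar h,
    sum_sampleProb_mul M δ lam fun x j => lam x / zeta M δ lam x * (M.γ * w j - w x.1),
    sub_eq_add_neg, ← Finset.sum_neg_distrib]
  congr 1
  refine Finset.sum_congr rfl fun x _ => ?_
  have e : ∑ j, M.P x.2 x.1 j * (lam x / zeta M δ lam x * (M.γ * w j - w x.1))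
      = -(lam x / zeta M δ lam x * M.bellman w x) := by
    have e3 : ∀ j, M.P x.2 x.1 j * (lam x / zeta M δ lam x * (M.γ * w j - w x.1))
        = lam x / zeta M δ lam x * M.γ * (M.P x.2 x.1 j * w j)
          - M.P x.2 x.1 j * (lam x / zeta M δ lam x * w x.1) := fun j => by ring
    simp only [e3]
    rw [Finset.sum_sub_distrib, ← Finset.mul_sum, ← Finset.sum_mul, M.P_sum]
    unfold MDP.bellman
    ring
  rw [e]
  have := (hz x).ne'
  field_simp

/-- The weight `lam / ζ` is at most `2 / (1 - γ)`, since `δ ≤ 1/2`; the constant is `2 + 4 · 4 =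
18`. -/
theorem sum_gradV_sq_le {M : MDP S A} {δ : ℝ} {lam : S × A → ℝ}
    (hδ : 0 ≤ δ) (hδ' : δ ≤ 1 / 2) (hlam : ∀ x, 0 < lam x) (z : Sample S A) :
    ∑ i, gradV M δ lam z i ^ 2 ≤ 18 / (1 - M.γ) ^ 2 := by
  have hG := M.one_sub_pos
  have hz : 0 < zeta M δ lam (z.s, z.a) := zeta_pos hδ hδ' (hlam _)
  have hzg : (1 - M.γ) * lam (z.s, z.a) / 2 ≤ zeta M δ lam (z.s, z.a) :=
    zeta_ge hδ hδ' (hlam _).le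
  set ρ := lam (z.s, z.a) / zeta M δ lam (z.s, z.a) with hρ
  have hρ0 : 0 ≤ ρ := div_nonneg (hlam _).le hz.le
  have hρ2 : ρ ≤ 2 / (1 - M.γ) := by
    rw [hρ, div_le_div_iff₀ hz hG]; linarith
  have hρsq : ρ ^ 2 ≤ 4 / (1 - M.γ) ^ 2 := by
    calc ρ ^ 2 ≤ (2 / (1 - M.γ)) ^ 2 := pow_le_pow_left₀ hρ0 hρ2 2
      _ = _ := by rw [div_pow]; norm_num
  have hs : ∀ (s i : S), (Pi.single s 1 : S → ℝ) i ^ 2 = (Pi.single s 1 : S → ℝ) i := by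
    intro s i
    rw [Pi.single_apply]
    split_ifs <;> norm_num
  have hs0 : ∀ (s i : S), 0 ≤ (Pi.single s 1 : S → ℝ) i := fun s i => by
    rw [← hs]; exact sq_nonneg _
  have hsum : ∀ s : S, ∑ i, (Pi.single s 1 : S → ℝ) i = 1 := fun s => by simp
  have hone : 1 ≤ 1 / (1 - M.γ) ^ 2 := by
    rw [le_div_iff₀ (by positivity)]
    nlinarith [M.γ_pos]
  calc ∑ i, gradV M δ lam z i ^ 2
      ≤ ∑ i, (2 * (Pi.single z.sbar 1 : S → ℝ) i + 2 * ρ ^ 2 *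
          ((Pi.single z.s' 1 : S → ℝ) i + (Pi.single z.s 1 : S → ℝ) i)) := by
        refine Finset.sum_le_sum fun i _ => ?_
        simp only [gradV, if_pos hz, ← hρ]
        set a := (Pi.single z.sbar 1 : S → ℝ) i with ha
        set b := (Pi.single z.s' 1 : S → ℝ) i with hb
        set d := (Pi.single z.s 1 : S → ℝ) i with hd
        have ea : a ^ 2 = a := hs _ _
        have eb : b ^ 2 = b := hs _ _
        have ed : d ^ 2 = d := hs _ _
        have hb0 : 0 ≤ b := hs0 _ _
        have hd0 : 0 ≤ d := hs0 _ _
        have h1 : (M.γ * b - d) ^ 2 ≤ b + d := by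
          have h2 : M.γ ^ 2 * b ^ 2 ≤ b ^ 2 :=
            mul_le_of_le_one_left (sq_nonneg b) (pow_le_one₀ M.γ_pos.le M.γ_lt_one.le)
          have h3 := mul_nonneg M.γ_pos.le (mul_nonneg hb0 hd0)
          nlinarith
        have h4 := mul_le_mul_of_nonneg_left h1 (sq_nonneg ρ)
        nlinarith [sq_nonneg (a - ρ * (M.γ * b - d))]
    _ = 2 + 4 * ρ ^ 2 := by
        rw [Finset.sum_add_distrib, ← Finset.mul_sum, ← Finset.mul_sum, Finset.sum_add_distrib,
          hsum, hsum, hsum]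
        ring
    _ ≤ 18 / (1 - M.γ) ^ 2 := by
        have : 18 / (1 - M.γ) ^ 2 = 2 * (1 / (1 - M.γ) ^ 2) + 4 * (4 / (1 - M.γ) ^ 2) := by ring
        linarith

variable [DecidableEq A]

/-- The part of `gradLam` that is estimated from the sample. -/
def gain (M : MDP S A) (p : Params) (v : S → ℝ) (lam : S × A → ℝ) (z : Sample S A)
    (x : S × A) : ℝ :=
  payoff M p v (z.s, z.a) z.s' / zeta M p.δ lam (z.s, z.a) * (Pi.single (z.s, z.a) 1 : S × A → ℝ) x

theorem gradLam_eq {M : MDP S A} {μ : S × A → ℝ} {p : Params} {v : S → ℝ} {lam : S × A → ℝ}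
    (hδ : 0 ≤ p.δ) (hδ' : p.δ ≤ 1 / 2) (hlam : ∀ x, 0 < lam x) (z : Sample S A) (x : S × A) :
    gradLam M μ p v lam z x =
      gain M p v lam z x - p.c * cautionGrad M μ lam x - p.M₂ := by
  unfold gradLam gain payoff
  rw [if_pos (zeta_pos hδ hδ' (hlam _))]

theorem gain_nonpos {M : MDP S A} {p : Params} (hδ : 0 ≤ p.δ) (hδ' : p.δ ≤ 1 / 2)
    (hB : 1 ≤ 1 + p.c * p.σ) (hM : p.M₁ = 4 * (1 + p.c * p.σ) / (1 - M.γ))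
    {q : (S → ℝ) × (S × A → ℝ)} (hq : IsState M p q) (z : Sample S A) (x : S × A) :
    gain M p q.1 q.2 z x ≤ 0 := by
  refine mul_nonpos_of_nonpos_of_nonneg (div_nonpos_of_nonpos_of_nonneg
    (payoff_bounds hB hM hq.mem _ _).1 (zeta_pos hδ hδ' (hq.pos _)).le) ?_
  rw [Pi.single_apply]
  split_ifs <;> norm_num

theorem expect_gain [Nonempty S] {M : MDP S A} {p : Params} {v : S → ℝ} {lam : S × A → ℝ}
    (hδ : 0 ≤ p.δ) (hδ' : p.δ ≤ 1 / 2) (hlam : ∀ x, 0 < lam x) (d : S × A → ℝ) :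
    ∑ z, sampleProb M p.δ lam z * ∑ x, d x * gain M p v lam z x =
      ∑ x, d x * (M.expRew x - M.bellman v x - p.M₁) := by
  have h : ∀ z : Sample S A, ∑ x, d x * gain M p v lam z x
      = d (z.s, z.a) * (payoff M p v (z.s, z.a) z.s' / zeta M p.δ lam (z.s, z.a)) := by
    intro z
    simp [gain, Pi.single_apply]
  simp only [h]
  rw [sum_sampleProb_mul M p.δ lam fun x j => d x * (payoff M p v x j / zeta M p.δ lam x)]
  refine Finset.sum_congr rfl fun x _ => ?_
  have hz := (zeta_pos hδ hδ' (hlam x) : 0 < zeta M p.δ lam x).ne'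
  have e1 : ∑ j, M.P x.2 x.1 j * (d x * (payoff M p v x j / zeta M p.δ lam x))
      = d x / zeta M p.δ lam x * ∑ j, M.P x.2 x.1 j * payoff M p v x j := by
    rw [Finset.mul_sum]
    exact Finset.sum_congr rfl fun j _ => by ring
  have e2 : ∑ j, M.P x.2 x.1 j * payoff M p v x j = M.expRew x - M.bellman v x - p.M₁ := by
    have e3 : ∀ j, M.P x.2 x.1 j * payoff M p v x j = M.P x.2 x.1 j * M.rew x.1 j x.2
        + M.γ * (M.P x.2 x.1 j * v j) - M.P x.2 x.1 j * (v x.1 + p.M₁) := fun j => by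
      unfold payoff; ring
    simp only [e3]
    rw [Finset.sum_sub_distrib, Finset.sum_add_distrib, ← Finset.mul_sum, ← Finset.sum_mul,
      M.P_sum]
    unfold MDP.expRew MDP.bellman
    ring
  rw [e1, e2]
  field_simp

/-- In this local norm one `1 / ζ` cancels against the sampling law and the other against `(1 - γ)
lam ≤ 2 ζ`. Each pair then costs `2 · 64 R²`, with no dependence on `δ` or on the smallest
coordinate. -/
theorem expect_gain_sq_le [Nonempty S] {M : MDP S A} {p : Params} (hδ : 0 ≤ p.δ)
    (hδ' : p.δ ≤ 1 / 2) (hB : 1 ≤ 1 + p.c * p.σ)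
    (hM : p.M₁ = 4 * (1 + p.c * p.σ) / (1 - M.γ))
    {q : (S → ℝ) × (S × A → ℝ)} (hq : IsState M p q) :
    ∑ z, sampleProb M p.δ q.2 z * ∑ x, (1 - M.γ) * q.2 x * gain M p q.1 q.2 z x ^ 2 ≤
      (Fintype.card S : ℝ) * Fintype.card A * (128 * ((1 + p.c * p.σ) / (1 - M.γ)) ^ 2) := by
  have h : ∀ z : Sample S A, ∑ x, (1 - M.γ) * q.2 x * gain M p q.1 q.2 z x ^ 2
      = (1 - M.γ) * q.2 (z.s, z.a) *
        (payoff M p q.1 (z.s, z.a) z.s' / zeta M p.δ q.2 (z.s, z.a)) ^ 2 := by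
    intro z
    simp [gain, Pi.single_apply]
  simp only [h]
  rw [sum_sampleProb_mul M p.δ q.2
    fun x j => (1 - M.γ) * q.2 x * (payoff M p q.1 x j / zeta M p.δ q.2 x) ^ 2]
  have hcard : (Fintype.card S : ℝ) * Fintype.card A * (128 * ((1 + p.c * p.σ) / (1 - M.γ)) ^ 2)
      = ∑ _x : S × A, 128 * ((1 + p.c * p.σ) / (1 - M.γ)) ^ 2 := by
    simp
  rw [hcard]
  refine Finset.sum_le_sum fun x _ => ?_
  have hz : 0 < zeta M p.δ q.2 x := zeta_pos hδ hδ' (hq.pos x)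
  have hzg : (1 - M.γ) * q.2 x / 2 ≤ zeta M p.δ q.2 x := zeta_ge hδ hδ' (hq.pos x).le
  have hpq : 0 < (1 - M.γ) * q.2 x := mul_pos M.one_sub_pos (hq.pos x)
  set R := (1 + p.c * p.σ) / (1 - M.γ) with hR
  have h1 : ∑ j, M.P x.2 x.1 j * ((1 - M.γ) * q.2 x * (payoff M p q.1 x j / zeta M p.δ q.2 x) ^ 2)
      ≤ (1 - M.γ) * q.2 x * (64 * R ^ 2) / zeta M p.δ q.2 x ^ 2 := by
    calc _ ≤ ∑ j, M.P x.2 x.1 j * ((1 - M.γ) * q.2 x * (64 * R ^ 2) / zeta M p.δ q.2 x ^ 2) := by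
          refine Finset.sum_le_sum fun j _ => mul_le_mul_of_nonneg_left ?_ (M.P_nonneg _ _ _)
          rw [div_pow, mul_div_assoc]
          have := (payoff_bounds hB hM hq.mem x j).2
          gcongr
      _ = _ := by rw [← Finset.sum_mul, M.P_sum, one_mul]
  calc zeta M p.δ q.2 x * _
      ≤ zeta M p.δ q.2 x * ((1 - M.γ) * q.2 x * (64 * R ^ 2) / zeta M p.δ q.2 x ^ 2) := by gcongr
    _ = (1 - M.γ) * q.2 x / zeta M p.δ q.2 x * (64 * R ^ 2) := by field_simp
    _ ≤ 2 * (64 * R ^ 2) := by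
        gcongr
        rw [div_le_iff₀ hz]
        linarith
    _ = _ := by ring

/-! ### Expected drift of the potential in one iteration. -/

theorem step_snd {M : MDP S A} {μ : S × A → ℝ} {p : Params} (hβ : 0 < p.β)
    {q : (S → ℝ) × (S × A → ℝ)} (hq : ∀ x, 0 < q.2 x) (z : Sample S A) (x : S × A) :
    (step M μ p q z).2 x = q.2 x * Real.exp (p.β * gradLam M μ p q.1 q.2 z x) /
      ((1 - M.γ) * ∑ y, q.2 y * Real.exp (p.β * gradLam M μ p q.1 q.2 z y)) := by
  have h0 : ∀ y, 0 < q.2 y * Real.exp (p.β * gradLam M μ p q.1 q.2 z y - 1) :=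
    fun y => mul_pos (hq y) (Real.exp_pos _)
  simp only [step, rescale, halfStep_eq hβ _ hq, abs_of_pos (h0 _)]
  simp only [sub_eq_add_neg, Real.exp_add, ← mul_assoc]
  rw [← Finset.sum_mul, ← mul_assoc, mul_div_mul_right _ _ (Real.exp_pos _).ne']

theorem IsState.step [Nonempty S] [Nonempty A] {M : MDP S A} {μ : S × A → ℝ} {p : Params}
    (hβ : 0 < p.β) {q : (S → ℝ) × (S × A → ℝ)} (hq : IsState M p q) (z : Sample S A) :
    IsState M p (step M μ p q z) := by
  have hG := M.one_sub_pos
  have hZ : 0 < ∑ y, q.2 y * Real.exp (p.β * gradLam M μ p q.1 q.2 z y) :=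
    Finset.sum_pos (fun y _ => mul_pos (hq.pos y) (Real.exp_pos _)) Finset.univ_nonempty
  refine ⟨(project_spec ⟨q.1, hq.mem⟩ _).1, fun x => ?_, ?_⟩
  · rw [step_snd hβ hq.pos]
    exact div_pos (mul_pos (hq.pos x) (Real.exp_pos _)) (mul_pos hG hZ)
  · simp only [step_snd hβ hq.pos]
    rw [← Finset.sum_div, mul_comm, ← div_div, div_self hZ.ne', one_div]

/-- The Lyapunov function of the analysis: distance to the saddle point `(vStar, lamStar)`. -/
def potential (M : MDP S A) (p : Params) (vStar : S → ℝ) (lamStar : S × A → ℝ)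
    (q : (S → ℝ) × (S × A → ℝ)) : ℝ :=
  kl (fun x => (1 - M.γ) * lamStar x) (fun x => (1 - M.γ) * q.2 x) / ((1 - M.γ) * p.β)
    + (∑ s, (q.1 s - vStar s) ^ 2) / (2 * p.α)

/-- The error of one iteration; `D` bounds `(1 - γ) log (1 / μ)`. -/
def stepError (M : MDP S A) (p : Params) (D : ℝ) : ℝ :=
  p.β / (1 - M.γ) *
      ((Fintype.card S : ℝ) * Fintype.card A * (128 * ((1 + p.c * p.σ) / (1 - M.γ)) ^ 2))
    + p.β * p.c ^ 2 / (1 - M.γ) * (32 * (1 - M.γ) ^ 2 + D ^ 2)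
    + 9 * p.α / (1 - M.γ) ^ 2

/-- Mirror step with `η = β c (1 - γ)`. The shift `M₂` and the constant part of the caution gradient
enter only through `k`, which normalization cancels. The entropic error is bounded for every sample,
without averaging. -/
theorem kl_step_le [Nonempty S] [Nonempty A] {M : MDP S A} {μ lamStar : S × A → ℝ} {p : Params}
    {D : ℝ} (hc : 0 < p.c) (hσ : 0 ≤ p.σ) (hδ : 0 ≤ p.δ) (hδ' : p.δ ≤ 1 / 2) (hβ : 0 < p.β)
    (hη : p.β * p.c * (1 - M.γ) ≤ 3 / 4) (hM : p.M₁ = 4 * (1 + p.c * p.σ) / (1 - M.γ))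
    (hμ : ∀ x, 0 < μ x) (hμ1 : ∑ x, μ x = 1) (hD : ∀ x, (1 - M.γ) * Real.log (1 / μ x) ≤ D)
    (hpos : ∀ x, 0 < lamStar x) (hsum : ∑ x, lamStar x = (1 - M.γ)⁻¹)
    {q : (S → ℝ) × (S × A → ℝ)} (hq : IsState M p q) (z : Sample S A) :
    kl (fun x => (1 - M.γ) * lamStar x) (fun x => (1 - M.γ) * (step M μ p q z).2 x)
        / ((1 - M.γ) * p.β) ≤
      kl (fun x => (1 - M.γ) * lamStar x) (fun x => (1 - M.γ) * q.2 x) / ((1 - M.γ) * p.β)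
      - ∑ x, (lamStar x - q.2 x) * gain M p q.1 q.2 z x
      + p.c * (caution M μ lamStar - caution M μ q.2)
      + p.β / (1 - M.γ) * ∑ x, (1 - M.γ) * q.2 x * gain M p q.1 q.2 z x ^ 2
      + p.β * p.c ^ 2 / (1 - M.γ) * (32 * (1 - M.γ) ^ 2 + D ^ 2) := by
  have hG := M.one_sub_pos
  have hu0 : ∀ x, 0 < (1 - M.γ) * lamStar x := fun x => mul_pos hG (hpos x)
  have hp0 : ∀ x, 0 < (1 - M.γ) * q.2 x := fun x => mul_pos hG (hq.pos x)
  have hp1 : ∑ x, (1 - M.γ) * q.2 x = 1 := by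
    rw [← Finset.mul_sum, hq.sum, mul_inv_cancel₀ hG.ne']
  have hB : 1 ≤ 1 + p.c * p.σ := by nlinarith
  have hη0 : 0 ≤ p.β * p.c * (1 - M.γ) := by positivity
  have hexp : ∀ x, p.β * gradLam M μ p q.1 q.2 z x =
      p.β * gain M p q.1 q.2 z x
        - p.β * p.c * (1 - M.γ) * Real.log ((1 - M.γ) * q.2 x / μ x)
        + -(p.β * (p.c * (1 - M.γ) + p.M₂)) := by
    intro x
    rw [gradLam_eq hδ hδ' hq.pos]
    unfold cautionGrad
    ring
  have key := kl_mirror_step_le (u := fun x => (1 - M.γ) * lamStar x)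
    (p := fun x => (1 - M.γ) * q.2 x) (p' := fun x => (1 - M.γ) * (step M μ p q z).2 x)
    (μ := μ) (gain := gain M p q.1 q.2 z) (β := p.β) (η := p.β * p.c * (1 - M.γ))
    (k := -(p.β * (p.c * (1 - M.γ) + p.M₂))) hu0
    (by rw [← Finset.mul_sum, hsum, mul_inv_cancel₀ hG.ne']) hp0 hp1 hμ
    (gain_nonpos hδ hδ' hB hM hq z) hβ.le hη0 (fun x => by
      simp only [step_snd hβ hq.pos, ← hexp, mul_assoc (1 - M.γ)]
      rw [← Finset.mul_sum, ← mul_div_assoc])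
  have hK : (1 - M.γ) ^ 2 * ∑ x, (1 - M.γ) * q.2 x *
      Real.log ((1 - M.γ) * q.2 x / μ x) ^ 2 *
        max 1 (Real.exp (-(p.β * p.c * (1 - M.γ)) * Real.log ((1 - M.γ) * q.2 x / μ x)))
      ≤ 32 * (1 - M.γ) ^ 2 + D ^ 2 := by
    rw [Finset.mul_sum]
    calc _ ≤ ∑ x, (32 * (1 - M.γ) ^ 2 * μ x + D ^ 2 * ((1 - M.γ) * q.2 x)) := by
          refine Finset.sum_le_sum fun x _ => ?_
          refine entropy_second_order_le (hp0 x) ?_ (hμ x) hη0 hη hG (hD x)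
          exact (Finset.single_le_sum (fun y _ => (hp0 y).le) (Finset.mem_univ x)).trans_eq hp1
      _ = _ := by
          rw [Finset.sum_add_distrib, ← Finset.mul_sum, ← Finset.mul_sum, hμ1, hp1, mul_one,
            mul_one]
  set K := ∑ x, (1 - M.γ) * q.2 x *
      Real.log ((1 - M.γ) * q.2 x / μ x) ^ 2 *
        max 1 (Real.exp (-(p.β * p.c * (1 - M.γ)) * Real.log ((1 - M.γ) * q.2 x / μ x))) with hKdef
  have hlin : ∑ x, ((1 - M.γ) * lamStar x - (1 - M.γ) * q.2 x) * gain M p q.1 q.2 z x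
      = (1 - M.γ) * ∑ x, (lamStar x - q.2 x) * gain M p q.1 q.2 z x := by
    rw [Finset.mul_sum]
    exact Finset.sum_congr rfl fun x _ => by ring
  rw [hlin] at key
  have hK2 := mul_le_mul_of_nonneg_left hK (by positivity : 0 ≤ p.β * p.c ^ 2 / (1 - M.γ))
  have hGβ : 0 < (1 - M.γ) * p.β := mul_pos hG hβ
  rw [div_le_iff₀ hGβ]
  refine key.trans ?_
  unfold caution
  have e1 : (kl (fun x => (1 - M.γ) * lamStar x) (fun x => (1 - M.γ) * q.2 x) / ((1 - M.γ) * p.β)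
      - ∑ x, (lamStar x - q.2 x) * gain M p q.1 q.2 z x
      + p.c * (kl (fun x => (1 - M.γ) * lamStar x) μ - kl (fun x => (1 - M.γ) * q.2 x) μ)
      + p.β / (1 - M.γ) * ∑ x, (1 - M.γ) * q.2 x * gain M p q.1 q.2 z x ^ 2
      + p.β * p.c ^ 2 / (1 - M.γ) * ((1 - M.γ) ^ 2 * K)) * ((1 - M.γ) * p.β)
      = kl (fun x => (1 - M.γ) * lamStar x) (fun x => (1 - M.γ) * q.2 x)
        - p.β * ((1 - M.γ) * ∑ x, (lamStar x - q.2 x) * gain M p q.1 q.2 z x)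
        + p.β * p.c * (1 - M.γ) * (kl (fun x => (1 - M.γ) * lamStar x) μ
          - kl (fun x => (1 - M.γ) * q.2 x) μ)
        + p.β ^ 2 * ∑ x, (1 - M.γ) * q.2 x * gain M p q.1 q.2 z x ^ 2
        + (p.β * p.c * (1 - M.γ)) ^ 2 * K := by
    field_simp
  rw [← e1]
  refine mul_le_mul_of_nonneg_right ?_ hGβ.le
  linarith

theorem sum_sq_step_le {M : MDP S A} {μ : S × A → ℝ} {p : Params} (hδ : 0 ≤ p.δ)
    (hδ' : p.δ ≤ 1 / 2) (hα : 0 < p.α) {vStar : S → ℝ}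
    (hvStar : vStar ∈ valueRegion M p.c p.σ) {q : (S → ℝ) × (S × A → ℝ)} (hq : IsState M p q)
    (z : Sample S A) :
    (∑ s, ((step M μ p q z).1 s - vStar s) ^ 2) / (2 * p.α) ≤
      (∑ s, (q.1 s - vStar s) ^ 2) / (2 * p.α)
      - ∑ i, gradV M p.δ q.2 z i * (q.1 i - vStar i) + 9 * p.α / (1 - M.γ) ^ 2 := by
  have h1 := sum_sq_project_sub_le (fun s => q.1 s - p.α * gradV M p.δ q.2 z s) hvStar
  have h2 : ∑ s, (q.1 s - p.α * gradV M p.δ q.2 z s - vStar s) ^ 2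
      = ∑ s, (q.1 s - vStar s) ^ 2
        - 2 * p.α * ∑ i, gradV M p.δ q.2 z i * (q.1 i - vStar i)
        + p.α ^ 2 * ∑ i, gradV M p.δ q.2 z i ^ 2 := by
    rw [Finset.mul_sum, Finset.mul_sum, ← Finset.sum_sub_distrib, ← Finset.sum_add_distrib]
    exact Finset.sum_congr rfl fun s _ => by ring
  have h3 := mul_le_mul_of_nonneg_left (sum_gradV_sq_le (M := M) hδ hδ' hq.pos z) (sq_nonneg p.α)
  rw [h2] at h1
  rw [div_le_iff₀ (by positivity)]
  have e : ((∑ s, (q.1 s - vStar s) ^ 2) / (2 * p.α)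
      - ∑ i, gradV M p.δ q.2 z i * (q.1 i - vStar i) + 9 * p.α / (1 - M.γ) ^ 2) * (2 * p.α)
      = ∑ s, (q.1 s - vStar s) ^ 2
        - 2 * p.α * ∑ i, gradV M p.δ q.2 z i * (q.1 i - vStar i)
        + p.α ^ 2 * (18 / (1 - M.γ) ^ 2) := by
    field_simp
    ring
  rw [e]
  exact h1.trans (by linarith)

/-- The expected decrease of the potential in one iteration. -/
theorem expect_potential_step_le [Nonempty S] [Nonempty A] {M : MDP S A}
    {μ lamStar : S × A → ℝ} {p : Params} {D : ℝ} {vStar : S → ℝ}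
    (hc : 0 < p.c) (hσ : 0 ≤ p.σ) (hδ : 0 ≤ p.δ) (hδ' : p.δ ≤ 1 / 2) (hα : 0 < p.α)
    (hβ : 0 < p.β) (hη : p.β * p.c * (1 - M.γ) ≤ 3 / 4)
    (hM : p.M₁ = 4 * (1 + p.c * p.σ) / (1 - M.γ))
    (hμ : ∀ x, 0 < μ x) (hμ1 : ∑ x, μ x = 1) (hD : ∀ x, (1 - M.γ) * Real.log (1 / μ x) ≤ D)
    (hfeas : lamStar ∈ feasible M) (hpos : ∀ x, 0 < lamStar x)
    (hv : ∀ x, M.expRew x - p.c * cautionGrad M μ lamStar x = M.bellman vStar x)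
    (hvStar : vStar ∈ valueRegion M p.c p.σ)
    {q : (S → ℝ) × (S × A → ℝ)} (hq : IsState M p q) :
    ∑ z, sampleProb M p.δ q.2 z * potential M p vStar lamStar (step M μ p q z) ≤
      potential M p vStar lamStar q
      - p.c * kl (fun x => (1 - M.γ) * q.2 x) (fun x => (1 - M.γ) * lamStar x)
      + stepError M p D := by
  have hG := M.one_sub_pos
  have hB : 1 ≤ 1 + p.c * p.σ := by nlinarith
  have hsum := sum_eq_of_mem_dualRegion hfeas.1
  have hpr := sum_sampleProb (δ := p.δ) hq.sum
  set C₁ := potential M p vStar lamStar q + p.c * (caution M μ lamStar - caution M μ q.2)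
    + p.β * p.c ^ 2 / (1 - M.γ) * (32 * (1 - M.γ) ^ 2 + D ^ 2) + 9 * p.α / (1 - M.γ) ^ 2 with hC₁
  have hz : ∀ z, potential M p vStar lamStar (step M μ p q z) ≤
      C₁ - ∑ x, (lamStar x - q.2 x) * gain M p q.1 q.2 z x
        + p.β / (1 - M.γ) * ∑ x, (1 - M.γ) * q.2 x * gain M p q.1 q.2 z x ^ 2
        - ∑ i, gradV M p.δ q.2 z i * (q.1 i - vStar i) := by
    intro z
    have h1 := kl_step_le hc hσ hδ hδ' hβ hη hM hμ hμ1 hD hpos hsum hq z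
    have h2 := sum_sq_step_le (μ := μ) hδ hδ' hα hvStar hq z
    rw [hC₁]
    unfold potential
    linarith
  have hE1 := expect_gain (M := M) (p := p) (v := q.1) hδ hδ' hq.pos fun x => lamStar x - q.2 x
  have hE2 := expect_gain_sq_le hδ hδ' hB hM hq
  have hE3 := expect_gradV hδ hδ' hq.pos hq.sum fun i => q.1 i - vStar i
  have hbound : ∑ z, sampleProb M p.δ q.2 z * potential M p vStar lamStar (step M μ p q z) ≤
      C₁ - ∑ x, (lamStar x - q.2 x) * (M.expRew x - M.bellman q.1 x - p.M₁)
        + p.β / (1 - M.γ) * ∑ z, sampleProb M p.δ q.2 z *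
            ∑ x, (1 - M.γ) * q.2 x * gain M p q.1 q.2 z x ^ 2
        - (∑ s, (q.1 s - vStar s) * xi S s
          - ∑ x, q.2 x * M.bellman (fun i => q.1 i - vStar i) x) := by
    rw [← hE1, ← hE3]
    calc _ ≤ ∑ z, sampleProb M p.δ q.2 z *
        (C₁ - ∑ x, (lamStar x - q.2 x) * gain M p q.1 q.2 z x
        + p.β / (1 - M.γ) * ∑ x, (1 - M.γ) * q.2 x * gain M p q.1 q.2 z x ^ 2
        - ∑ i, gradV M p.δ q.2 z i * (q.1 i - vStar i)) :=
          Finset.sum_le_sum fun z _ =>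
            mul_le_mul_of_nonneg_left (hz z) (sampleProb_nonneg hδ hδ' hq.pos z)
      _ = _ := by
          simp only [mul_sub, mul_add, Finset.sum_sub_distrib, Finset.sum_add_distrib]
          rw [← Finset.sum_mul, hpr, one_mul, Finset.mul_sum]
          congr 2
          exact Finset.sum_congr rfl fun z _ => by ring
  have hbel : ∑ x, q.2 x * M.bellman (fun i => q.1 i - vStar i) x
      = ∑ x, q.2 x * M.bellman q.1 x - ∑ x, q.2 x * M.bellman vStar x := by
    rw [← Finset.sum_sub_distrib]
    refine Finset.sum_congr rfl fun x _ => ?_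
    simp only [MDP.bellman, mul_sub, Finset.sum_sub_distrib]
    ring
  have hxi : ∑ s, (q.1 s - vStar s) * xi S s = ∑ s, q.1 s * xi S s - ∑ s, vStar s * xi S s := by
    rw [← Finset.sum_sub_distrib]
    exact Finset.sum_congr rfl fun x _ => by ring
  -- `M₁` disappears because both vectors have the same mass, and feasibility turns the pairing of
  -- `lamStar` with `bellman` into the `ξ`-average of `v`.
  have hpay : ∑ x, (lamStar x - q.2 x) * (M.expRew x - M.bellman q.1 x - p.M₁)
      = ∑ x, lamStar x * M.expRew x - ∑ x, q.2 x * M.expRew x - ∑ s, q.1 s * xi S s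
        + ∑ x, q.2 x * M.bellman q.1 x := by
    have : ∀ x, (lamStar x - q.2 x) * (M.expRew x - M.bellman q.1 x - p.M₁)
        = lamStar x * M.expRew x - q.2 x * M.expRew x - lamStar x * M.bellman q.1 x
          + q.2 x * M.bellman q.1 x - (lamStar x * p.M₁ - q.2 x * p.M₁) := fun x => by ring
    simp only [this, Finset.sum_sub_distrib, Finset.sum_add_distrib]
    rw [← Finset.sum_mul, ← Finset.sum_mul, hsum, hq.sum, sum_bellman_of_feasible hfeas]
    ring
  -- All terms in the current `v` cancel between the two players; what is left is the Lagrangian gap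
  -- at `vStar`.
  have hgap := mul_kl_eq_gap hμ hfeas hpos hv hq.pos hq.sum
  have hE2' := mul_le_mul_of_nonneg_left hE2 (by positivity : 0 ≤ p.β / (1 - M.γ))
  rw [hbel, hxi, hpay] at hbound
  rw [hgap]
  refine hbound.trans ?_
  rw [hC₁]
  unfold stepError
  linarith

end

/-! ### Telescoping along the random path and averaging the iterates. -/

section

variable {S A : Type*} [Fintype S] [Fintype A]

theorem initLam_sum [Nonempty S] [Nonempty A] (M : MDP S A) :
    ∑ x, initLam M x = (1 - M.γ)⁻¹ := by
  have hG := M.one_sub_pos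
  have hA : (Fintype.card A : ℝ) ≠ 0 := by exact_mod_cast Fintype.card_ne_zero
  have hS : (Fintype.card S : ℝ) ≠ 0 := by exact_mod_cast Fintype.card_ne_zero
  simp only [initLam, Finset.sum_const, Finset.card_univ, Fintype.card_prod, nsmul_eq_mul]
  push_cast
  field_simp

theorem kl_initLam_le [Nonempty S] [Nonempty A] {M : MDP S A} {lamStar : S × A → ℝ}
    (hpos : ∀ x, 0 < lamStar x) (hsum : ∑ x, lamStar x = (1 - M.γ)⁻¹) :
    kl (fun x => (1 - M.γ) * lamStar x) (fun x => (1 - M.γ) * initLam M x) ≤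
      Real.log ((Fintype.card S : ℝ) * Fintype.card A) := by
  have hG := M.one_sub_pos
  have hA : (0 : ℝ) < Fintype.card A := by exact_mod_cast Fintype.card_pos
  have hS : (0 : ℝ) < Fintype.card S := by exact_mod_cast Fintype.card_pos
  have hp1 : ∑ x, (1 - M.γ) * lamStar x = 1 := by
    rw [← Finset.mul_sum, hsum, mul_inv_cancel₀ hG.ne']
  have hp0 : ∀ x, 0 < (1 - M.γ) * lamStar x := fun x => mul_pos hG (hpos x)
  have hrhs : Real.log ((Fintype.card S : ℝ) * Fintype.card A)
      = ∑ x, (1 - M.γ) * lamStar x * Real.log ((Fintype.card S : ℝ) * Fintype.card A) := by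
    rw [← Finset.sum_mul, hp1, one_mul]
  rw [hrhs]
  unfold kl
  refine Finset.sum_le_sum fun x _ => ?_
  have hx1 : (1 - M.γ) * lamStar x ≤ 1 :=
    (Finset.single_le_sum (fun y _ => (hp0 y).le) (Finset.mem_univ x)).trans_eq hp1
  refine mul_le_mul_of_nonneg_left ?_ (hp0 x).le
  have hi : (1 - M.γ) * initLam M x = 1 / ((Fintype.card S : ℝ) * Fintype.card A) := by
    unfold initLam
    field_simp
  simp only
  rw [hi, div_div_eq_mul_div, div_one]
  refine Real.log_le_log (mul_pos (hp0 x) (mul_pos hS hA)) ?_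
  exact mul_le_of_le_one_left (mul_pos hS hA).le hx1

theorem potential_nonneg {M : MDP S A} {p : Params} (hα : 0 < p.α) (hβ : 0 < p.β)
    {vStar : S → ℝ} {lamStar : S × A → ℝ} (hpos : ∀ x, 0 < lamStar x)
    (hsum : ∑ x, lamStar x = (1 - M.γ)⁻¹) {q : (S → ℝ) × (S × A → ℝ)} (hq : IsState M p q) :
    0 ≤ potential M p vStar lamStar q := by
  have hG := M.one_sub_pos
  refine add_nonneg (div_nonneg (kl_nonneg (fun x => (mul_pos hG (hpos x)).le)
    (fun x => mul_pos hG (hq.pos x)) ?_) (mul_pos hG hβ).le)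
    (div_nonneg (Finset.sum_nonneg fun s _ => sq_nonneg _) (by positivity))
  rw [← Finset.mul_sum, ← Finset.mul_sum, hsum, hq.sum]

theorem potential_init_le [Nonempty S] [Nonempty A] {M : MDP S A} {p : Params} (hα : 0 < p.α)
    (hβ : 0 < p.β) {vStar v₁ : S → ℝ} {lamStar : S × A → ℝ} (hpos : ∀ x, 0 < lamStar x)
    (hsum : ∑ x, lamStar x = (1 - M.γ)⁻¹) (hv₁ : v₁ ∈ valueRegion M p.c p.σ)
    (hvStar : vStar ∈ valueRegion M p.c p.σ) :
    potential M p vStar lamStar (v₁, initLam M) ≤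
      Real.log ((Fintype.card S : ℝ) * Fintype.card A) / ((1 - M.γ) * p.β)
        + Fintype.card S * (16 * ((1 + p.c * p.σ) / (1 - M.γ)) ^ 2) / (2 * p.α) := by
  have hG := M.one_sub_pos
  unfold potential
  refine add_le_add (div_le_div_of_nonneg_right (kl_initLam_le hpos hsum) (mul_pos hG hβ).le)
    (div_le_div_of_nonneg_right ?_ (by positivity))
  calc ∑ s, (v₁ s - vStar s) ^ 2
      ≤ ∑ _s : S, 16 * ((1 + p.c * p.σ) / (1 - M.γ)) ^ 2 := by
        refine Finset.sum_le_sum fun s _ => ?_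
        have a1 := abs_le.1 (hv₁ s)
        have a2 := abs_le.1 (hvStar s)
        nlinarith
    _ = _ := by simp

variable [DecidableEq S] [DecidableEq A]

section Path

variable {M : MDP S A} {μ : S × A → ℝ} {p : Params} {v₁ : S → ℝ}

theorem iterate_succ_of_lt {T t : ℕ} (z : Fin T → Sample S A) (h : t < T) :
    iterate M μ p v₁ z (t + 1) = step M μ p (iterate M μ p v₁ z t) (z ⟨t, h⟩) := by
  rw [iterate, dif_pos h]

/-- Iterate `t` reads only samples with index below `t`, so `t = m` is still allowed. -/
theorem iterate_snoc {m : ℕ} (z : Fin m → Sample S A) (x : Sample S A) {t : ℕ} (ht : t ≤ m) :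
    iterate M μ p v₁ (Fin.snoc z x : Fin (m + 1) → Sample S A) t = iterate M μ p v₁ z t := by
  induction t with
  | zero => rfl
  | succ t ih =>
    have h : t < m := ht
    rw [iterate_succ_of_lt _ (h.trans (Nat.lt_succ_self m)), iterate_succ_of_lt _ h, ih h.le]
    congr 1
    exact Fin.snoc_castSucc (α := fun _ => Sample S A) x z ⟨t, h⟩

theorem iterate_snoc_last {m : ℕ} (z : Fin m → Sample S A) (x : Sample S A) :
    iterate M μ p v₁ (Fin.snoc z x : Fin (m + 1) → Sample S A) (m + 1) =
      step M μ p (iterate M μ p v₁ z m) x := by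
  rw [iterate_succ_of_lt _ (Nat.lt_succ_self m), iterate_snoc z x le_rfl]
  congr 1
  exact Fin.snoc_last (α := fun _ => Sample S A) x z

theorem pathProb_snoc {m : ℕ} (z : Fin m → Sample S A) (x : Sample S A) :
    pathProb M μ p v₁ (Fin.snoc z x : Fin (m + 1) → Sample S A) =
      pathProb M μ p v₁ z * sampleProb M p.δ (iterate M μ p v₁ z m).2 x := by
  unfold pathProb
  rw [Fin.prod_univ_castSucc]
  congr 1
  · refine Finset.prod_congr rfl fun t _ => ?_
    rw [Fin.val_castSucc, iterate_snoc z x t.2.le, Fin.snoc_castSucc]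
  · rw [Fin.val_last, iterate_snoc z x le_rfl, Fin.snoc_last]

/-- The tower property: condition on the first `m` samples and average over the last one. -/
theorem sum_path_succ {m : ℕ} (F : (Fin (m + 1) → Sample S A) → ℝ) :
    ∑ z, pathProb M μ p v₁ z * F z =
      ∑ z : Fin m → Sample S A, pathProb M μ p v₁ z *
        ∑ x, sampleProb M p.δ (iterate M μ p v₁ z m).2 x * F (Fin.snoc z x) := by
  rw [← Equiv.sum_comp (Fin.snocEquiv fun _ => Sample S A), Fintype.sum_prod_type_right]
  refine Finset.sum_congr rfl fun z _ => ?_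
  rw [Finset.mul_sum]
  refine Finset.sum_congr rfl fun x _ => ?_
  rw [← mul_assoc, ← pathProb_snoc]
  rfl

theorem IsState.iterate [Nonempty S] [Nonempty A] (hβ : 0 < p.β)
    (h₁ : IsState M p (v₁, initLam M)) {T : ℕ} (z : Fin T → Sample S A) (t : ℕ) :
    IsState M p (iterate M μ p v₁ z t) := by
  induction t with
  | zero => exact h₁
  | succ t ih =>
    rw [CautiousRL.iterate]
    split_ifs
    · exact ih.step hβ _
    · exact ih

theorem pathProb_nonneg [Nonempty S] [Nonempty A] (hδ : 0 ≤ p.δ) (hδ' : p.δ ≤ 1 / 2)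
    (hβ : 0 < p.β) (h₁ : IsState M p (v₁, initLam M)) {T : ℕ} (z : Fin T → Sample S A) :
    0 ≤ pathProb M μ p v₁ z :=
  Finset.prod_nonneg fun t _ => sampleProb_nonneg hδ hδ' (h₁.iterate hβ z t).pos _

theorem sum_pathProb [Nonempty S] [Nonempty A] (hβ : 0 < p.β)
    (h₁ : IsState M p (v₁, initLam M)) (T : ℕ) :
    ∑ z : Fin T → Sample S A, pathProb M μ p v₁ z = 1 := by
  induction T with
  | zero => simp [pathProb]
  | succ m ih =>
    have := sum_path_succ (M := M) (μ := μ) (p := p) (v₁ := v₁) (m := m) fun _ => 1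
    simp only [mul_one] at this
    rw [this, ← ih]
    exact Finset.sum_congr rfl fun z _ => by
      rw [sum_sampleProb (h₁.iterate hβ z m).sum, mul_one]

/-- A one-step drift inequality telescopes along the random path. -/
theorem expect_path_le [Nonempty S] [Nonempty A] (hδ : 0 ≤ p.δ) (hδ' : p.δ ≤ 1 / 2)
    (hβ : 0 < p.β) (h₁ : IsState M p (v₁, initLam M)) {Φ f : (S → ℝ) × (S × A → ℝ) → ℝ} {E : ℝ}
    (hdrift : ∀ q, IsState M p q →
      ∑ z, sampleProb M p.δ q.2 z * Φ (step M μ p q z) ≤ Φ q - f q + E) (T : ℕ) :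
    ∑ z : Fin T → Sample S A, pathProb M μ p v₁ z *
        (Φ (iterate M μ p v₁ z T) + ∑ t : Fin T, f (iterate M μ p v₁ z t)) ≤
      Φ (v₁, initLam M) + T * E := by
  induction T with
  | zero => simp [pathProb, iterate]
  | succ m ih =>
    rw [sum_path_succ]
    have hin : ∀ z : Fin m → Sample S A,
        ∑ x, sampleProb M p.δ (iterate M μ p v₁ z m).2 x *
          (Φ (iterate M μ p v₁ (Fin.snoc z x : Fin (m + 1) → Sample S A) (m + 1)) +
            ∑ t : Fin (m + 1), f (iterate M μ p v₁ (Fin.snoc z x : Fin (m + 1) → Sample S A) t))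
        ≤ Φ (iterate M μ p v₁ z m) + ∑ t : Fin m, f (iterate M μ p v₁ z t) + E := by
      intro z
      have hq : IsState M p (iterate M μ p v₁ z m) := h₁.iterate hβ z m
      have hs : ∀ x, ∑ t : Fin (m + 1),
          f (iterate M μ p v₁ (Fin.snoc z x : Fin (m + 1) → Sample S A) t)
          = ∑ t : Fin m, f (iterate M μ p v₁ z t) + f (iterate M μ p v₁ z m) := by
        intro x
        rw [Fin.sum_univ_castSucc, Fin.val_last, iterate_snoc z x le_rfl]
        congr 1
        exact Finset.sum_congr rfl fun t _ => by
          rw [Fin.val_castSucc, iterate_snoc z x t.2.le]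
      simp only [hs, iterate_snoc_last, mul_add, Finset.sum_add_distrib]
      rw [← Finset.sum_mul, ← Finset.sum_mul, sum_sampleProb hq.sum]
      linarith [hdrift _ hq]
    calc _ ≤ ∑ z : Fin m → Sample S A, pathProb M μ p v₁ z *
          (Φ (iterate M μ p v₁ z m) + ∑ t : Fin m, f (iterate M μ p v₁ z t) + E) :=
          Finset.sum_le_sum fun z _ =>
            mul_le_mul_of_nonneg_left (hin z) (pathProb_nonneg hδ hδ' hβ h₁ z)
      _ = ∑ z : Fin m → Sample S A, pathProb M μ p v₁ z *
          (Φ (iterate M μ p v₁ z m) + ∑ t : Fin m, f (iterate M μ p v₁ z t)) + E := by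
          simp only [mul_add, Finset.sum_add_distrib]
          rw [← Finset.sum_mul (f := fun z : Fin m → Sample S A => pathProb M μ p v₁ z),
            sum_pathProb hβ h₁, one_mul]
      _ ≤ _ := by push_cast; linarith

/-- Jensen's inequality in each coordinate for the convex function `y log (y / m)`. -/
theorem kl_output_le {lamStar : S × A → ℝ} (hpos : ∀ x, 0 < lamStar x) {T : ℕ} (hT : 0 < T)
    {z : Fin T → Sample S A} (hz : ∀ t x, 0 < (iterate M μ p v₁ z t).2 x) :
    kl (fun x => (1 - M.γ) * output M μ p v₁ z x) (fun x => (1 - M.γ) * lamStar x) ≤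
      1 / T * ∑ t : Fin T, kl (fun x => (1 - M.γ) * (iterate M μ p v₁ z t).2 x)
        (fun x => (1 - M.γ) * lamStar x) := by
  have hG := M.one_sub_pos
  have hT' : (0 : ℝ) < T := by exact_mod_cast hT
  unfold kl
  rw [Finset.sum_comm, Finset.mul_sum]
  refine Finset.sum_le_sum fun x _ => ?_
  have h := (convexOn_mul_log_div (mul_pos hG (hpos x))).map_sum_le (t := Finset.univ)
    (w := fun _ : Fin T => 1 / (T : ℝ)) (p := fun t => (1 - M.γ) * (iterate M μ p v₁ z t).2 x)
    (fun _ _ => by positivity) (by simp [hT'.ne'])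
    (fun t _ => (mul_pos hG (hz t x)).le)
  simp only [smul_eq_mul, ← Finset.mul_sum] at h
  convert h using 2
  · unfold output; ring
  · unfold output; congr 2; ring

end Path

/-- The regret bound for general step sizes. -/
theorem expOutput_kl_le [Nonempty S] [Nonempty A] {M : MDP S A}
    {μ lamStar : S × A → ℝ} {p : Params} {D : ℝ} {vStar v₁ : S → ℝ}
    (hc : 0 < p.c) (hσ : 0 ≤ p.σ) (hδ : 0 ≤ p.δ) (hδ' : p.δ ≤ 1 / 2) (hα : 0 < p.α)
    (hβ : 0 < p.β) (hη : p.β * p.c * (1 - M.γ) ≤ 3 / 4)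
    (hM : p.M₁ = 4 * (1 + p.c * p.σ) / (1 - M.γ))
    (hμ : ∀ x, 0 < μ x) (hμ1 : ∑ x, μ x = 1) (hD : ∀ x, (1 - M.γ) * Real.log (1 / μ x) ≤ D)
    (hfeas : lamStar ∈ feasible M) (hpos : ∀ x, 0 < lamStar x)
    (hv : ∀ x, M.expRew x - p.c * cautionGrad M μ lamStar x = M.bellman vStar x)
    (hvStar : vStar ∈ valueRegion M p.c p.σ) (hv₁ : v₁ ∈ valueRegion M p.c p.σ)
    {T : ℕ} (hT : 0 < T) :
    p.c * expOutput M μ p v₁ T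
        (fun lamBar => kl (fun x => (1 - M.γ) * lamBar x) (fun x => (1 - M.γ) * lamStar x)) ≤
      (Real.log ((Fintype.card S : ℝ) * Fintype.card A) / ((1 - M.γ) * p.β)
        + Fintype.card S * (16 * ((1 + p.c * p.σ) / (1 - M.γ)) ^ 2) / (2 * p.α)) / T
        + stepError M p D := by
  have hG := M.one_sub_pos
  have hT' : (0 : ℝ) < T := by exact_mod_cast hT
  have hsum := sum_eq_of_mem_dualRegion hfeas.1
  have hA : (0 : ℝ) < Fintype.card A := by exact_mod_cast Fintype.card_pos
  have hS : (0 : ℝ) < Fintype.card S := by exact_mod_cast Fintype.card_pos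
  have h₁ : IsState M p (v₁, initLam M) :=
    ⟨hv₁, fun x => by unfold initLam; positivity, initLam_sum M⟩
  set f : (S → ℝ) × (S × A → ℝ) → ℝ := fun q =>
    p.c * kl (fun x => (1 - M.γ) * q.2 x) (fun x => (1 - M.γ) * lamStar x) with hf
  have hpath := expect_path_le hδ hδ' hβ h₁ (Φ := potential M p vStar lamStar) (f := f)
    (fun q hq => expect_potential_step_le hc hσ hδ hδ' hα hβ hη hM hμ hμ1 hD hfeas hpos hv hvStar
      hq) T
  have hinit := potential_init_le hα hβ hpos hsum hv₁ hvStar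
  have hmain : T * (p.c * expOutput M μ p v₁ T
        (fun lamBar => kl (fun x => (1 - M.γ) * lamBar x) (fun x => (1 - M.γ) * lamStar x))) ≤
      ∑ z : Fin T → Sample S A, pathProb M μ p v₁ z *
        (potential M p vStar lamStar (iterate M μ p v₁ z T)
          + ∑ t : Fin T, f (iterate M μ p v₁ z t)) := by
    unfold expOutput
    rw [Finset.mul_sum, Finset.mul_sum]
    refine Finset.sum_le_sum fun z _ => ?_
    have hz := fun t => h₁.iterate (μ := μ) hβ z t
    have hj := kl_output_le hpos hT (fun t => (hz t).pos)
    have hj2 := mul_le_mul_of_nonneg_left hj (mul_pos hT' hc).le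
    have hΦ := potential_nonneg (vStar := vStar) hα hβ hpos hsum (hz T)
    calc _ = pathProb M μ p v₁ z * (T * p.c * kl (fun x => (1 - M.γ) * output M μ p v₁ z x)
          (fun x => (1 - M.γ) * lamStar x)) := by ring
      _ ≤ _ := by
        refine mul_le_mul_of_nonneg_left (hj2.trans ?_) (pathProb_nonneg hδ hδ' hβ h₁ z)
        simp only [hf]
        rw [← Finset.mul_sum]
        have : T * p.c * (1 / T * ∑ t : Fin T, kl (fun x => (1 - M.γ) * (iterate M μ p v₁ z t).2 x)
            (fun x => (1 - M.γ) * lamStar x)) = p.c * ∑ t : Fin T,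
              kl (fun x => (1 - M.γ) * (iterate M μ p v₁ z t).2 x)
                (fun x => (1 - M.γ) * lamStar x) := by
          field_simp
        rw [this]
        linarith
  have h := hmain.trans hpath
  rw [div_add' _ _ _ hT'.ne', le_div_iff₀ hT']
  linarith

/-- The error terms for the chosen step sizes, with `w = √(log n / (T n))`, `r = √(|S| / T)`. -/
theorem total_error_le {n s T L G c σ w r : ℝ} (hn : 2 ≤ n) (hT : 0 < T) (hG : 0 < G)
    (hG1 : G ≤ 1) (hGσ : G ≤ σ) (hc : 0 < c) (hw : 0 < w) (hL : L = w ^ 2 * T * n)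
    (hs : s = r ^ 2 * T) (hrw : r ≤ 2 * (n * w)) :
    (L / (G * (G / (1 + c * σ) * w)) + s * (16 * ((1 + c * σ) / G) ^ 2) / (2 * (r * (1 + c * σ)))) / T
      + (G / (1 + c * σ) * w / G * (n * (128 * ((1 + c * σ) / G) ^ 2))
        + G / (1 + c * σ) * w * c ^ 2 / G * (32 * G ^ 2 + 4 * n * σ ^ 2)
        + 9 * (r * (1 + c * σ)) / G ^ 2) ≤ 250 * (n * w * ((1 + c * σ) / G ^ 2)) := by
  have hσ : 0 < σ := hG.trans_le hGσ
  have hB : 0 < 1 + c * σ := by positivity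
  set B := 1 + c * σ with hBdef
  have e1 : (L / (G * (G / B * w)) + s * (16 * (B / G) ^ 2) / (2 * (r * B))) / T
      = n * w * (B / G ^ 2) + 8 * (r * (B / G ^ 2)) := by
    rw [hL, hs]
    field_simp
    ring
  have e2 : G / B * w / G * (n * (128 * (B / G) ^ 2)) = 128 * (n * w * (B / G ^ 2)) := by
    field_simp
  have e3 : 9 * (r * B) / G ^ 2 = 9 * (r * (B / G ^ 2)) := by ring
  have e4 : G / B * w * c ^ 2 / G * (32 * G ^ 2 + 4 * n * σ ^ 2) ≤ 20 * (n * w * (B / G ^ 2)) := by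
    have h1 : 32 * G ^ 2 + 4 * n * σ ^ 2 ≤ 20 * n * σ ^ 2 := by
      have : G ^ 2 ≤ σ ^ 2 := pow_le_pow_left₀ hG.le hGσ 2
      nlinarith [sq_nonneg σ]
    have h2 : (c * σ) ^ 2 ≤ B ^ 2 :=
      pow_le_pow_left₀ (by positivity) (by rw [hBdef]; linarith) 2
    have h3 : B ≤ B / G ^ 2 := by
      rw [le_div_iff₀ (by positivity)]
      exact mul_le_of_le_one_right hB.le (pow_le_one₀ hG.le hG1)
    calc G / B * w * c ^ 2 / G * (32 * G ^ 2 + 4 * n * σ ^ 2)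
        ≤ G / B * w * c ^ 2 / G * (20 * n * σ ^ 2) := by gcongr
      _ = 20 * (n * w * ((c * σ) ^ 2 / B)) := by field_simp
      _ ≤ 20 * (n * w * (B ^ 2 / B)) := by gcongr
      _ = 20 * (n * w * B) := by field_simp
      _ ≤ _ := by gcongr
  have hq : 0 < B / G ^ 2 := by positivity
  have e5 := mul_le_mul_of_nonneg_right hrw hq.le
  have e6 : 0 < n * w * (B / G ^ 2) := by positivity
  -- The total is `1 + 128 + 20` from the dual player and `8 + 9` multiples of `r ≤ 2 n w`, that is
  -- `149 + 34 = 183`.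
  rw [e1, e2, e3]
  nlinarith

end

end

end CautiousRL

/-! ### Choice of the universal constant. -/

theorem mainTheorem3 :
    ∃ C : ℝ, 0 < C ∧
      ∀ (S A : Type*) [Fintype S] [Fintype A] [DecidableEq S] [DecidableEq A]
        (M : CautiousRL.MDP S A) (μ : S × A → ℝ) (c σ δ₀ δ ε : ℝ) (T : ℕ) (v₁ : S → ℝ)
        (lamStar : S × A → ℝ),
        2 ≤ Fintype.card S * Fintype.card A →
        0 < c → 0 < ε → 0 < δ → δ < 1 / 2 →
        -- the prior is a distribution bounded below by `δ₀`
        0 < δ₀ → (∀ x, δ₀ ≤ μ x) → ∑ x, μ x = 1 →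
        -- `σ` bounds the gradient of the caution where `lam ≥ δ₀`
        (∀ lam ∈ CautiousRL.dualRegion M, (∀ x, δ₀ ≤ lam x) →
          ∀ x, |CautiousRL.cautionGrad M μ lam x| ≤ σ) →
        v₁ ∈ CautiousRL.valueRegion M c σ →
        CautiousRL.IsOptimal M c μ lamStar →
        C * ((Fintype.card S : ℝ) * (Fintype.card A : ℝ) *
            Real.log ((Fintype.card S : ℝ) * (Fintype.card A : ℝ)) * (1 + 2 * c * σ) ^ 2 /
          ((1 - M.γ) ^ 4 * ε ^ 2)) ≤ T →
        (∀ x, 0 < lamStar x) ∧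
        CautiousRL.expOutput M μ (CautiousRL.chosenParams M c σ δ T) v₁ T
          (fun lamBar =>
            CautiousRL.kl (fun x => (1 - M.γ) * lamBar x) (fun x => (1 - M.γ) * lamStar x))
          ≤ ε / c := by
  -- The regret is at most `250 n w (1 + c σ) / (1 - γ)²`; requiring this to be at most `ε` and
  -- squaring gives the threshold for `T`.
  refine ⟨250 ^ 2, by norm_num, ?_⟩
  intro S A _ _ _ _ M μ c σ δ₀ δ ε T v₁ lamStar hn hc hε hδ hδ' hδ₀ hμ hμ1 hσ hv₁ hopt hT
  have hS : 0 < Fintype.card S :=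
    Nat.pos_of_mul_pos_right (by omega : 0 < Fintype.card S * Fintype.card A)
  have hA : 0 < Fintype.card A :=
    Nat.pos_of_mul_pos_left (by omega : 0 < Fintype.card S * Fintype.card A)
  have hSne : Nonempty S := Fintype.card_pos_iff.1 hS
  have hAne : Nonempty A := Fintype.card_pos_iff.1 hA
  have hS' : (1 : ℝ) ≤ Fintype.card S := by exact_mod_cast hS
  have hA' : (1 : ℝ) ≤ Fintype.card A := by exact_mod_cast hA
  have hG := M.one_sub_pos
  have hG1 : 1 - M.γ ≤ 1 := by linarith [M.γ_pos]
  have hGσ := CautiousRL.one_sub_le_gradBound hn hδ₀ hμ hμ1 hσ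
  have hσ0 : 0 < σ := hG.trans_le hGσ
  have hμ0 : ∀ x, 0 < μ x := fun x => hδ₀.trans_le (hμ x)
  have hpos := hopt.pos hc hμ0
  refine ⟨hpos, ?_⟩
  obtain ⟨vStar, hv⟩ := hopt.exists_multiplier hc hμ0
  have hB : 0 < 1 + c * σ := by positivity
  have hvStar : vStar ∈ CautiousRL.valueRegion M c σ := fun s => by
    have h1 := CautiousRL.abs_multiplier_le hn hc hδ₀ hμ hμ1 hσ hopt.1 hpos hv s
    have h2 : 0 < (1 + c * σ) / (1 - M.γ) := by positivity
    linarith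
  have hD := CautiousRL.mul_log_inv_le hn hδ₀ hμ hμ1 hσ
  set n : ℝ := (Fintype.card S : ℝ) * (Fintype.card A : ℝ) with hnn
  have hn' : (2 : ℝ) ≤ n := by rw [hnn]; exact_mod_cast hn
  -- This lower bound, available since `n ≥ 2`, gives `|S| ≤ 4 n log n`, so that the error of `v` is
  -- absorbed by that of `lam`. It also makes the threshold positive, which forces `T ≥ 1`.
  have hL : 1 / 4 ≤ Real.log n := by
    have := Real.log_two_gt_d9
    have := Real.log_le_log (by norm_num) hn'
    linarith
  have hT0 : (0 : ℝ) < T := lt_of_lt_of_le (by positivity) hT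
  have hTpos : 0 < T := by exact_mod_cast hT0
  have hT1 : (1 : ℝ) ≤ T := by exact_mod_cast hTpos
  set w := Real.sqrt (Real.log n / (T * n)) with hw
  set r := Real.sqrt ((Fintype.card S : ℝ) / T) with hr
  have hw0 : 0 < w := Real.sqrt_pos.2 (by positivity)
  have hr0 : 0 < r := Real.sqrt_pos.2 (by positivity)
  have hw2 : w ^ 2 = Real.log n / (T * n) := Real.sq_sqrt (by positivity)
  have hr2 : r ^ 2 = Fintype.card S / T := Real.sq_sqrt (by positivity)
  have hLw : Real.log n = w ^ 2 * T * n := by rw [hw2]; field_simp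
  have hsr : (Fintype.card S : ℝ) = r ^ 2 * T := by rw [hr2]; field_simp
  have hrw : r ≤ 2 * (n * w) := by
    refine le_of_sq_le_sq ?_ (by positivity)
    have hSn : (Fintype.card S : ℝ) ≤ n := le_mul_of_one_le_right (by linarith) hA'
    have h1 : (Fintype.card S : ℝ) ≤ 4 * n * Real.log n := by nlinarith
    rw [mul_pow, mul_pow, hw2, hr2]
    calc (Fintype.card S : ℝ) / T ≤ 4 * n * Real.log n / T := by gcongr
      _ = _ := by field_simp; ring
  -- Needed for `η ≤ 3 / 4` in the entropy bound; `T ≥ 1` and `log n ≤ n / 2` give `w² ≤ 1 / 2`.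
  have hwle : w ≤ 3 / 4 := by
    refine le_of_sq_le_sq ?_ (by norm_num)
    have h1 : Real.log n / (T * n) ≤ 1 / 2 := by
      rw [div_le_iff₀ (by positivity)]
      have := CautiousRL.log_le_half (x := n) (by linarith)
      nlinarith
    rw [hw2]
    linarith
  set p := CautiousRL.chosenParams M c σ δ T with hp
  have hpα : p.α = r * (1 + c * σ) := rfl
  have hpβ : p.β = (1 - M.γ) / (1 + c * σ) * w := rfl
  have hpc : p.c = c := rfl
  have hpσ : p.σ = σ := rfl
  have hη : p.β * p.c * (1 - M.γ) ≤ 3 / 4 := by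
    rw [hpβ, hpc]
    have h1 : c * (1 - M.γ) / (1 + c * σ) ≤ 1 := by
      rw [div_le_one hB]; nlinarith
    calc (1 - M.γ) / (1 + c * σ) * w * c * (1 - M.γ)
        = (c * (1 - M.γ) / (1 + c * σ)) * ((1 - M.γ) * w) := by ring
      _ ≤ 1 * (1 * w) := by gcongr
      _ ≤ 3 / 4 := by linarith
  have hreg := CautiousRL.expOutput_kl_le (p := p) (v₁ := v₁) hc hσ0.le hδ.le hδ'.le
    (by rw [hpα]; positivity) (by rw [hpβ]; positivity) hη rfl hμ0 hμ1 hD hopt.1 hpos hv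
    hvStar hv₁ hTpos
  have htot := CautiousRL.total_error_le hn' hT0 hG hG1 hGσ hc hw0 hLw hsr hrw
  have hDsq : (σ * (2 * Real.sqrt n)) ^ 2 = 4 * n * σ ^ 2 := by
    rw [mul_pow, mul_pow, Real.sq_sqrt (by linarith)]; ring
  have hfin : 250 * (n * w * ((1 + c * σ) / (1 - M.γ) ^ 2)) ≤ ε := by
    refine le_of_sq_le_sq ?_ hε.le
    have h1 : (1 + c * σ) ^ 2 ≤ (1 + 2 * c * σ) ^ 2 :=
      pow_le_pow_left₀ hB.le (by rw [mul_assoc]; exact add_le_add_right (by linarith [mul_pos hc hσ0]) 1) 2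
    rw [← mul_div_assoc, div_le_iff₀ (by positivity)] at hT
    have e : (250 * (n * w * ((1 + c * σ) / (1 - M.γ) ^ 2))) ^ 2
        = 250 ^ 2 * (n * Real.log n * (1 + c * σ) ^ 2) / (T * (1 - M.γ) ^ 4) := by
      rw [mul_pow, mul_pow, mul_pow, hw2]
      field_simp
    rw [e, div_le_iff₀ (by positivity)]
    calc 250 ^ 2 * (n * Real.log n * (1 + c * σ) ^ 2)
        ≤ 250 ^ 2 * (n * Real.log n * (1 + 2 * c * σ) ^ 2) := by gcongr
      _ ≤ _ := hT
      _ = _ := by ring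
  clear_value p w r
  unfold CautiousRL.stepError at hreg
  rw [hpα, hpβ, hpc, hpσ, hDsq] at hreg
  rw [le_div_iff₀ hc, mul_comm]
  exact hreg.trans (htot.trans hfin)
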